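/- Let $N\ge 2$ be an integer and let $B,L\subset\mathbb Z$ be finite sets with $\#B=\#L\ge 2$, $0\in B\cap L$ and $\#B<N$, such that $(N,B,L)$ is a Hadamard triple, i.e. the matrix $\big(\tfrac{1}{\sqrt{\#B}}e^{2\pi i b\ell/N}\big)_{b\in B,\,\ell\in L}$ is unitary. Write $\tau_a(x)=(x+a)/N$. Let $\mu_{N,B}$ be the self-similar measure, i.e. the unique Borel probability measure on $\mathbb R$ with $\mu=\frac1{\#B}\sum_{b\in B}\mu\circ\tau_b^{-1}$. A finite set $C=\{x_1,\dots,x_r\}\subset\mathbb R$ with $r\ge1$ is an $m_B$-cycle if there are $\ell_1,\dots,\ell_r\in L$ with $\tau_{\ell_j}(x_j)=x_{j+1}$ for $1\le j<r$ and $\tau_{\ell_r}(x_r)=x_1$, and $\big|\frac1{\#B}\sum_{b\in B}e^{2\pi i b x_j}\big|=1$ for all $j$. Let $\Lambda\subset\mathbb R$ be the smallest set that contains $-C$ for every $m_B$-cycle $C$ and satisfies $N\Lambda+L\subset\Lambda$; $(\mu_{N,B},\Lambda)$ is the canonical spectral pair generated by $(N,B,L)$. A real number $t$ is a spectral eigenvalue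 of $(\mu_{N,B},\Lambda)$ if $(\mu_{N,B},t\Lambda)$ is a spectral pair, i.e. $t\Lambda$ is countable and $\{e^{2\pi i\lambda x}:\lambda\in t\Lambda\}$ is an orthonormal basis of $L^2(\mu_{N,B})$. Let $p_1,\dots,p_k$ be distinct primes with $\gcd(p_1p_2\cdots p_k,N)=1$. Then there is an integer $n_0\ge 0$, depending only on $(N,B,L)$ and $p_1,\dots,p_k$, such that for every integer $n\ge n_0$: if $(p_1p_2\cdots p_k)^{n}$ is a spectral eigenvalue of $(\mu_{N,B},\Lambda)$, then $p_1^{n_1}p_2^{n_2}\cdots p_k^{n_k}$ is a spectral eigenvalue of $(\mu_{N,B},\Lambda)$ for all non-negative integers $n_1,\dots,n_k$. -/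

import Mathlib

open MeasureTheory
open scoped Pointwise ENNReal

noncomputable section

namespace CanonicalSpectrum

/-! ### Hadamard triples -/

/-- The matrix `(#B)^{-1/2} e^{2πi bℓ/N}` with rows `b ∈ B` and columns `ℓ ∈ L`. -/
def hadamardMatrix (N : ℕ) (B L : Finset ℤ) : Matrix B L ℂ :=
  Matrix.of fun b l =>
    (1 / (Real.sqrt (B.card : ℝ) : ℂ)) *
      Complex.exp (2 * Real.pi * Complex.I * (((b : ℤ) : ℂ) * ((l : ℤ) : ℂ) / (N : ℂ)))

/-- `(N, B, L)` is a Hadamard triple in `ℝ`. Rows and columns of the matrix are indexed by different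
types, so unitarity is stated as two-sided invertibility by the conjugate transpose. -/
structure IsHadamardTriple (N : ℕ) (B L : Finset ℤ) : Prop where
  two_le : 2 ≤ N
  card_eq : B.card = L.card
  two_le_card : 2 ≤ B.card
  mul_conjTranspose : hadamardMatrix N B L * (hadamardMatrix N B L).conjTranspose = 1
  conjTranspose_mul : (hadamardMatrix N B L).conjTranspose * hadamardMatrix N B L = 1

/-- The digit set `B` of a Hadamard triple is not empty. -/
theorem IsHadamardTriple.nonempty {N : ℕ} {B L : Finset ℤ} (h : IsHadamardTriple N B L) :
    B.Nonempty :=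
  Finset.card_pos.1 (lt_of_lt_of_le Nat.zero_lt_two h.two_le_card)

/-! ### The self-similar measure -/

/-- The contraction `τ_a(x) = (x + a) / N`. -/
def tau (N : ℕ) (a : ℤ) (x : ℝ) : ℝ := (x + (a : ℝ)) / (N : ℝ)

/-- `μ` is a Borel probability measure with `μ = (1/#B) ∑_{b ∈ B} μ ∘ τ_b⁻¹`. -/
structure IsSelfSimilarMeasure (N : ℕ) (B : Finset ℤ) (μ : Measure ℝ) : Prop where
  isProbabilityMeasure : IsProbabilityMeasure μ
  eq_sum : μ = (B.card : ℝ≥0∞)⁻¹ • ∑ b ∈ B, μ.map (tau N b)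

/-- The uniform probability measure on the digit set `B`. -/
def digitMeasure (B : Finset ℤ) (hB : B.Nonempty) : Measure B :=
  haveI : Nonempty B := hB.to_subtype
  (PMF.uniformOfFintype B).toMeasure

/-- The uniform measure on the digits is a probability measure. -/
instance digitMeasure_isProbabilityMeasure (B : Finset ℤ) (hB : B.Nonempty) :
    IsProbabilityMeasure (digitMeasure B hB) := by
  unfold digitMeasure
  infer_instance

/-- The point `∑_{k ≥ 1} b_k N^{-k}` with digit sequence `(b_k)` in `B`. -/
def digitSeries (N : ℕ) (B : Finset ℤ) (w : ℕ → B) : ℝ :=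
  ∑' k : ℕ, (((w k : ℤ) : ℝ)) / (N : ℝ) ^ (k + 1)

/-- The self-similar measure `μ_{N,B}`, built as the law of `∑_{k ≥ 1} b_k N^{-k}` with independent
digits `b_k` that are uniform on `B`. For `N ≥ 2` it is the unique measure satisfying
`IsSelfSimilarMeasure N B`: see `isSelfSimilarMeasure_selfSimilarMeasure` and
`IsSelfSimilarMeasure.unique`. -/
def selfSimilarMeasure (N : ℕ) (B : Finset ℤ) (hB : B.Nonempty) : Measure ℝ :=
  (Measure.infinitePi fun _ : ℕ => digitMeasure B hB).map (digitSeries N B)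

theorem summable_digitSeries {N : ℕ} (hN : 2 ≤ N) (B : Finset ℤ) (w : ℕ → B) :
    Summable fun k : ℕ => (((w k : ℤ) : ℝ)) / (N : ℝ) ^ (k + 1) := by
  have hN1 : (1 : ℝ) < N := by exact_mod_cast (by omega : 1 < N)
  have hN0 : (0 : ℝ) < N := by linarith
  obtain ⟨M, hM⟩ : ∃ M : ℝ, ∀ b ∈ B, |((b : ℤ) : ℝ)| ≤ M := by
    refine ⟨∑ b ∈ B, |((b : ℤ) : ℝ)|, fun b hb => ?_⟩
    exact Finset.single_le_sum (f := fun b : ℤ => |(b : ℝ)|) (fun _ _ => abs_nonneg _) hb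
  have hg : Summable fun k : ℕ => M * ((N : ℝ)⁻¹) ^ (k + 1) := by
    refine Summable.mul_left M ?_
    exact (summable_nat_add_iff 1).2
      (summable_geometric_of_lt_one (by positivity) (inv_lt_one_of_one_lt₀ hN1))
  refine Summable.of_norm_bounded hg fun k => ?_
  rw [norm_div, norm_pow, Real.norm_eq_abs, Real.norm_eq_abs, abs_of_pos hN0, inv_pow,
    div_eq_mul_inv]
  exact mul_le_mul_of_nonneg_right (hM _ (w k).2) (by positivity)

theorem measurable_digitSeries (N : ℕ) (B : Finset ℤ) : Measurable (digitSeries N B) := by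
  unfold digitSeries
  have h (k : ℕ) : Measurable fun w : ℕ → B => (((w k : ℤ) : ℝ)) / (N : ℝ) ^ (k + 1) :=
    ((measurable_of_countable fun b : B => ((b : ℤ) : ℝ)).comp (measurable_pi_apply k)).div_const _
  exact Measurable.tsum h

theorem measurable_tau (N : ℕ) (a : ℤ) : Measurable (tau N a) := by
  unfold tau
  fun_prop

instance selfSimilarMeasure_isProbabilityMeasure (N : ℕ) (B : Finset ℤ) (hB : B.Nonempty) :
    IsProbabilityMeasure (selfSimilarMeasure N B hB) :=
  Measure.isProbabilityMeasure_map (measurable_digitSeries N B).aemeasurable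

theorem digitSeries_cons {N : ℕ} (hN : 2 ≤ N) (B : Finset ℤ) (b : B) (w : ℕ → B) :
    digitSeries N B (fun n => Nat.casesOn n b w) = tau N b (digitSeries N B w) := by
  have hN0 : (N : ℝ) ≠ 0 := by
    have : N ≠ 0 := by omega
    exact_mod_cast this
  unfold digitSeries tau
  rw [(summable_digitSeries hN B _).tsum_eq_zero_add, add_div, ← tsum_div_const, add_comm]
  congr 1
  · refine tsum_congr fun k => ?_
    show ((w k : ℤ) : ℝ) / _ = _
    rw [div_div, ← pow_succ]
  · simp

theorem infinitePi_map_cons {X : Type*} [MeasurableSpace X] (ν : Measure X)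
    [IsProbabilityMeasure ν] :
    (ν.prod (Measure.infinitePi fun _ : ℕ => ν)).map
      (fun q : X × (ℕ → X) => (fun n => Nat.casesOn n q.1 q.2 : ℕ → X)) =
      Measure.infinitePi fun _ : ℕ => ν := by
  classical
  have hm : Measurable (fun q : X × (ℕ → X) => (fun n => Nat.casesOn n q.1 q.2 : ℕ → X)) := by
    refine measurable_pi_lambda _ fun n => ?_
    cases n with
    | zero => exact measurable_fst
    | succ n => exact (measurable_pi_apply n).comp measurable_snd
  refine Measure.eq_infinitePi _ fun s t ht => ?_
  obtain ⟨m, hsm⟩ : ∃ m, s ⊆ Finset.range (m + 1) :=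
    ⟨s.sup id, fun i hi => Finset.mem_range.2 (Nat.lt_succ_of_le (Finset.le_sup (f := id) hi))⟩
  set t' : ℕ → Set X := fun i => if i ∈ s then t i else Set.univ with ht'
  have ht'm (i : ℕ) : MeasurableSet (t' i) := by
    by_cases hi : i ∈ s <;> simp [t', hi, ht]
  have hset : (s : Set ℕ).pi t = (Finset.range (m + 1) : Set ℕ).pi t' := by
    ext f
    simp only [Set.mem_pi, Finset.mem_coe]
    constructor
    · intro h i _
      by_cases hi : i ∈ s
      · simpa [t', hi] using h i hi
      · simp [t', hi]
    · intro h i hi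
      simpa [t', hi] using h i (hsm hi)
  have hprod : ∏ i ∈ s, ν (t i) = ∏ i ∈ Finset.range (m + 1), ν (t' i) := by
    rw [← Finset.prod_subset hsm]
    · exact Finset.prod_congr rfl fun i hi => by simp [t', hi]
    · intro i _ hi
      simp [t', hi]
  have hpre : (fun q : X × (ℕ → X) => (fun n => Nat.casesOn n q.1 q.2 : ℕ → X)) ⁻¹'
      ((Finset.range (m + 1) : Set ℕ).pi t') =
      t' 0 ×ˢ ((Finset.range m : Set ℕ).pi fun i => t' (i + 1)) := by
    ext ⟨x, w⟩
    simp only [Set.mem_preimage, Set.mem_pi, Finset.mem_coe, Finset.mem_range, Set.mem_prod]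
    constructor
    · exact fun h => ⟨h 0 (by omega), fun i hi => h (i + 1) (by omega)⟩
    · rintro ⟨h0, h1⟩ i hi
      cases i with
      | zero => exact h0
      | succ i => exact h1 i (by omega)
  have hbox : MeasurableSet ((Finset.range (m + 1) : Set ℕ).pi t') :=
    MeasurableSet.pi (Finset.countable_toSet _) fun i _ => ht'm i
  rw [hset, hprod, Measure.map_apply hm hbox, hpre, Measure.prod_prod, Measure.infinitePi_pi _
    (fun i _ => ht'm (i + 1)), Finset.prod_range_succ', mul_comm]

/-- The law of the random digit series solves the self-similarity equation. -/
theorem isSelfSimilarMeasure_selfSimilarMeasure {N : ℕ} (hN : 2 ≤ N) (B : Finset ℤ)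
    (hB : B.Nonempty) : IsSelfSimilarMeasure N B (selfSimilarMeasure N B hB) := by
  refine ⟨inferInstance, ?_⟩
  have : Nonempty B := hB.to_subtype
  have hX := measurable_digitSeries N B
  ext s hs
  have hm : Measurable (fun q : B × (ℕ → B) => (fun n => Nat.casesOn n q.1 q.2 : ℕ → B)) := by
    refine measurable_pi_lambda _ fun n => ?_
    cases n with
    | zero => exact measurable_fst
    | succ n => exact (measurable_pi_apply n).comp measurable_snd
  have h1 : selfSimilarMeasure N B hB s = ∑ b : B, (B.card : ℝ≥0∞)⁻¹ *
      (selfSimilarMeasure N B hB) (tau N b ⁻¹' s) := by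
    conv_lhs => rw [selfSimilarMeasure, ← infinitePi_map_cons (digitMeasure B hB)]
    rw [Measure.map_map hX hm, Measure.map_apply (hX.comp hm) hs,
      Measure.prod_apply ((hX.comp hm) hs), lintegral_fintype]
    refine Finset.sum_congr rfl fun b _ => ?_
    rw [mul_comm]
    congr 1
    · simp [digitMeasure]
    · rw [selfSimilarMeasure, Measure.map_apply hX (measurable_tau N b hs)]
      congr 1
      ext w
      simp only [Set.mem_preimage, Function.comp_apply]
      rw [digitSeries_cons hN]
  rw [h1, Measure.smul_apply, Measure.finsetSum_apply, smul_eq_mul, Finset.mul_sum,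
    ← Finset.sum_coe_sort B]
  refine Finset.sum_congr rfl fun b _ => ?_
  rw [Measure.map_apply (measurable_tau N b) hs]

/-- The self-similarity equation has at most one solution. -/
theorem IsSelfSimilarMeasure.unique {N : ℕ} (hN : 2 ≤ N) {B : Finset ℤ} (hB : B.Nonempty)
    {μ ν : Measure ℝ} (hμ : IsSelfSimilarMeasure N B μ) (hν : IsSelfSimilarMeasure N B ν) :
    μ = ν := by
  have := hμ.isProbabilityMeasure
  have := hν.isProbabilityMeasure
  have key (ρ : Measure ℝ) (hρ : IsSelfSimilarMeasure N B ρ) (t : ℝ) :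
      charFun ρ t = ((B.card : ℂ)⁻¹ * ∑ b ∈ B, Complex.exp (t * (b / N) * Complex.I)) *
        charFun ρ (t / N) := by
    have := hρ.isProbabilityMeasure
    have hint (b : ℤ) : Integrable (fun x : ℝ => Complex.exp (t * x * Complex.I))
        (ρ.map (tau N b)) := by
      have := Measure.isProbabilityMeasure_map (μ := ρ) (measurable_tau N b).aemeasurable
      refine Integrable.of_bound (C := 1) (by fun_prop) (Filter.Eventually.of_forall fun x => ?_)
      rw [← Complex.ofReal_mul, Complex.norm_exp_ofReal_mul_I]
    conv_lhs => rw [hρ.eq_sum]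
    rw [charFun_apply_real, integral_smul_measure, integral_finsetSum_measure fun b _ => hint b]
    rw [charFun_apply_real, mul_assoc, Finset.sum_mul]
    have hc : ((B.card : ℝ≥0∞)⁻¹).toReal = (B.card : ℝ)⁻¹ := by simp
    rw [hc, Complex.real_smul]
    push_cast
    congr 1
    refine Finset.sum_congr rfl fun b _ => ?_
    rw [integral_map (measurable_tau N b).aemeasurable (by fun_prop), ← integral_const_mul]
    refine integral_congr_ae (Filter.Eventually.of_forall fun x => ?_)
    simp only [tau]
    rw [← Complex.exp_add]
    congr 1
    push_cast
    ring
  have hstep (t : ℝ) : ‖charFun μ t - charFun ν t‖ ≤ ‖charFun μ (t / N) - charFun ν (t / N)‖ := by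
    rw [key μ hμ t, key ν hν t, ← mul_sub, norm_mul]
    refine mul_le_of_le_one_left (norm_nonneg _) ?_
    rw [norm_mul, norm_inv, Complex.norm_natCast]
    have hpos : (0 : ℝ) < B.card := by exact_mod_cast hB.card_pos
    have hs : ‖∑ b ∈ B, Complex.exp ((t : ℂ) * (b / N) * Complex.I)‖ ≤ B.card := by
      refine (norm_sum_le _ _).trans ?_
      have (b : ℤ) : ‖Complex.exp ((t : ℂ) * (b / N) * Complex.I)‖ = 1 := by
        have h := Complex.norm_exp_ofReal_mul_I (t * (b / N))
        push_cast at h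
        exact h
      simp [this]
    calc (B.card : ℝ)⁻¹ * ‖∑ b ∈ B, Complex.exp ((t : ℂ) * (b / N) * Complex.I)‖
        ≤ (B.card : ℝ)⁻¹ * B.card := by gcongr
      _ = 1 := inv_mul_cancel₀ hpos.ne'
  have hiter (t : ℝ) (n : ℕ) : ‖charFun μ t - charFun ν t‖ ≤
      ‖charFun μ (t / N ^ n) - charFun ν (t / N ^ n)‖ := by
    induction n with
    | zero => simp
    | succ n ih =>
      refine ih.trans ((hstep _).trans_eq ?_)
      rw [div_div, ← pow_succ]
  refine Measure.ext_of_charFun (funext fun t => ?_)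
  have hN1 : (1 : ℝ) < N := by exact_mod_cast (by omega : 1 < N)
  have hlim : Filter.Tendsto (fun n : ℕ => t / (N : ℝ) ^ n) Filter.atTop (nhds 0) :=
    Filter.Tendsto.div_atTop tendsto_const_nhds (tendsto_pow_atTop_atTop_of_one_lt hN1)
  have hcont : Continuous fun t : ℝ => ‖charFun μ t - charFun ν t‖ := by fun_prop
  have h0 := (hcont.tendsto 0).comp hlim
  simp only [charFun_zero, probReal_univ, sub_self, norm_zero] at h0
  have := ge_of_tendsto' h0 (hiter t)
  exact sub_eq_zero.1 (norm_le_zero_iff.1 this)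

/-! ### Spectral pairs -/

/-- `(μ, Λ)` is a spectral pair: `Λ` is countable and the exponentials `e_λ(x) = e^{2πiλx}`,
`λ ∈ Λ`, form an orthonormal basis of `L²(μ)`. -/
def IsSpectralPair (μ : Measure ℝ) [IsProbabilityMeasure μ] (Λ : Set ℝ) : Prop :=
  Λ.Countable ∧ ∃ e : HilbertBasis Λ ℂ (Lp ℂ 2 μ), ∀ l : Λ,
    (e l : ℝ → ℂ) =ᵐ[μ] fun x => Complex.exp (2 * Real.pi * Complex.I * ((l : ℝ) * x : ℝ))

/-- `t` is a spectral eigenvalue of `(μ, Λ)`: `(μ, tΛ)` is also a spectral pair. -/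
def IsSpectralEigenvalue (μ : Measure ℝ) [IsProbabilityMeasure μ] (Λ : Set ℝ) (t : ℝ) : Prop :=
  IsSpectralPair μ (t • Λ)

/-! ### The canonical spectrum -/

/-- `m_B(x) = (1/#B) ∑_{b ∈ B} e^{2πibx}`. -/
def maskFunction (B : Finset ℤ) (x : ℝ) : ℂ :=
  (1 / (B.card : ℂ)) * ∑ b ∈ B, Complex.exp (2 * Real.pi * Complex.I * ((b : ℂ) * (x : ℂ)))

/-- `C = {x_0, …, x_k}` is a cycle: `τ_{ℓ_j}(x_j) = x_{j+1}` with `ℓ_j ∈ L`, where the index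
`j + 1` is taken cyclically (addition in `Fin (k + 1)` wraps around). -/
def IsCycle (N : ℕ) (L : Finset ℤ) (C : Set ℝ) : Prop :=
  ∃ (k : ℕ) (x : Fin (k + 1) → ℝ) (l : Fin (k + 1) → ℤ),
    C = Set.range x ∧ ∀ j, l j ∈ L ∧ tau N (l j) (x j) = x (j + 1)

/-- An `m_B`-cycle (extreme cycle). -/
def IsExtremeCycle (N : ℕ) (B L : Finset ℤ) (C : Set ℝ) : Prop :=
  IsCycle N L C ∧ ∀ x ∈ C, ‖maskFunction B x‖ = 1

/-- The smallest set `Λ` that contains `-C` for all `m_B`-cycles `C` and satisfies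
`NΛ + L ⊆ Λ`. -/
def canonicalSpectrum (N : ℕ) (B L : Finset ℤ) : Set ℝ :=
  ⋂₀ {S : Set ℝ | (∀ C, IsExtremeCycle N B L C → -C ⊆ S) ∧
    ∀ x ∈ S, ∀ l ∈ L, (N : ℝ) * x + (l : ℝ) ∈ S}

end CanonicalSpectrum

end

noncomputable section

namespace CanonicalSpectrum

/-! Fix `t` coprime to `N`. Galois conjugation `ζ ↦ ζ^t` of `N`-th roots of unity shows that `(N, B,
tL)` inherits the Hadamard relations, with the same measure (`HadamardRelations.dilate`). Its
canonical spectrum `Λ(tL)` is therefore a spectrum (`HadamardRelations.isSpectralPair`), and it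
contains `tΛ`. No orthonormal basis is a proper part of an orthonormal family, so `t` is a spectral
eigenvalue exactly when `tΛ = Λ(tL)`. Since `|m_B| = 1` exactly on `periodGroup B`, this says that a
periodic point `x` of the maps `τ_ℓ` with `tx` in the period group already lies in it:
`IsSaturatedAt`.

Saturation concerns only the order `q` of `x` modulo the period group: failure at `t` means that
some periodic `x` has order `q > 1` dividing `t`. If the orders dividing powers of `P = p_1⋯p_k` are
at most `Q`, then each of them divides `P ^ n` for all `n ≥ Q`, so saturation at `P ^ n` gives
saturation at every divisor of every power of `P`.

The bound `Q` (`exists_addOrderOf_le`) comes from estimating in two ways the least `r > 0` with `(N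
^ r - 1)x` in the period group. Lifting the exponent gives `q ≤ const * r`
(`dvd_totient_pow_sub_one_mul`). On the other hand, with `N ^ (k - 1) < q ≤ N ^ k`, a point reached
after `k` steps is fixed by its last `k` digits up to boundedly many choices, so `r ≤ const * (#L) ^
k` (`length_le`). As `#L = #B < N`, the two estimates bound `k`, hence `q`.

Completeness of `Λ` rests on `Q(x) = ∑ |μ̂(x + λ)|²`, which is at most one by Bessel, analytic, and
harmonic for a transfer operator. Its minimum on an invariant interval is attained at a point of an
extreme cycle, unless `Q` is constant; in both cases `Q ≥ 1` (`one_le_of_harmonic`). -/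

/-! ### The exponential `x ↦ e^{2πix}` -/

/-- `unitExp x = e^{2πix}`. -/
def unitExp (x : ℝ) : ℂ := Complex.exp (2 * Real.pi * Complex.I * (x : ℂ))

theorem unitExp_zero : unitExp 0 = 1 := by simp [unitExp]

theorem unitExp_add (x y : ℝ) : unitExp (x + y) = unitExp x * unitExp y := by
  rw [unitExp, unitExp, unitExp, ← Complex.exp_add]
  push_cast
  ring_nf

theorem unitExp_eq_exp_mul_I (x : ℝ) :
    unitExp x = Complex.exp (((2 * Real.pi * x : ℝ) : ℂ) * Complex.I) := by
  rw [unitExp]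
  push_cast
  ring_nf

theorem norm_unitExp (x : ℝ) : ‖unitExp x‖ = 1 := by
  rw [unitExp_eq_exp_mul_I, Complex.norm_exp_ofReal_mul_I]

theorem conj_unitExp (x : ℝ) : (starRingEnd ℂ) (unitExp x) = unitExp (-x) := by
  rw [unitExp, unitExp, ← Complex.exp_conj]
  simp [Complex.conj_ofReal, Complex.conj_ofNat]

theorem continuous_unitExp : Continuous unitExp := by
  unfold unitExp
  fun_prop

theorem unitExp_eq_one_iff {x : ℝ} : unitExp x = 1 ↔ ∃ n : ℤ, x = n := by
  rw [unitExp, Complex.exp_eq_one_iff]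
  refine exists_congr fun n => ?_
  have h : (2 * Real.pi * Complex.I : ℂ) ≠ 0 := Complex.two_pi_I_ne_zero
  rw [mul_comm, mul_left_inj' h]
  exact_mod_cast Iff.rfl

theorem unitExp_intCast (n : ℤ) : unitExp n = 1 := unitExp_eq_one_iff.2 ⟨n, rfl⟩

/-! ### The mask function and its period group -/

theorem maskFunction_eq (B : Finset ℤ) (x : ℝ) :
    maskFunction B x = (B.card : ℂ)⁻¹ * ∑ b ∈ B, unitExp (b * x) := by
  rw [maskFunction, one_div]
  congr 1
  refine Finset.sum_congr rfl fun b _ => ?_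
  rw [unitExp]
  push_cast
  rfl

/-- The points `x` with `bx ∈ ℤ` for all `b ∈ B`. -/
def periodGroup (B : Finset ℤ) : AddSubgroup ℝ where
  carrier := {x | ∀ b ∈ B, ∃ n : ℤ, (b : ℝ) * x = n}
  zero_mem' := fun b _ => ⟨0, by simp⟩
  add_mem' := by
    intro x y hx hy b hb
    obtain ⟨m, hm⟩ := hx b hb
    obtain ⟨n, hn⟩ := hy b hb
    exact ⟨m + n, by push_cast; rw [mul_add, hm, hn]⟩
  neg_mem' := by
    intro x hx b hb
    obtain ⟨m, hm⟩ := hx b hb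
    exact ⟨-m, by push_cast; rw [mul_neg, hm]⟩

theorem intCast_mem_periodGroup (B : Finset ℤ) (n : ℤ) : (n : ℝ) ∈ periodGroup B :=
  fun b _ => ⟨b * n, by push_cast; rfl⟩

theorem natCast_mul_mem_periodGroup {B : Finset ℤ} (n : ℕ) {x : ℝ} (hx : x ∈ periodGroup B) :
    (n : ℝ) * x ∈ periodGroup B := by
  simpa using (periodGroup B).nsmul_mem hx n

theorem maskFunction_add_of_mem {B : Finset ℤ} (x : ℝ) {y : ℝ} (hy : y ∈ periodGroup B) :
    maskFunction B (x + y) = maskFunction B x := by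
  rw [maskFunction_eq, maskFunction_eq]
  congr 1
  refine Finset.sum_congr rfl fun b hb => ?_
  rw [mul_add, unitExp_add, unitExp_eq_one_iff.2 (hy b hb), mul_one]

theorem maskFunction_zero {B : Finset ℤ} (hB : B.Nonempty) : maskFunction B 0 = 1 := by
  have : (B.card : ℂ) ≠ 0 := by exact_mod_cast hB.card_pos.ne'
  simp [maskFunction_eq, unitExp_zero, this]

theorem maskFunction_of_mem {B : Finset ℤ} (hB : B.Nonempty) {y : ℝ} (hy : y ∈ periodGroup B) :
    maskFunction B y = 1 := by
  have := maskFunction_add_of_mem 0 hy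
  rwa [zero_add, maskFunction_zero hB] at this

/-- Equality in the triangle inequality forces all terms to agree with the term of `b = 0`, which is
`1`. Bounding the other `#B - 2` terms trivially leaves `|1 + z| ≥ 2` for a single unimodular `z`,
whence `z = 1`. -/
theorem mem_periodGroup_of_norm_maskFunction {B : Finset ℤ} (h0 : (0 : ℤ) ∈ B) {x : ℝ}
    (hx : ‖maskFunction B x‖ = 1) : x ∈ periodGroup B := by
  intro b hb
  by_cases hb0 : b = 0
  · exact ⟨0, by simp [hb0]⟩
  rw [← unitExp_eq_one_iff]
  have hpos : (0 : ℝ) < B.card := by exact_mod_cast Finset.card_pos.2 ⟨0, h0⟩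
  have hsum : ‖∑ b ∈ B, unitExp (b * x)‖ = B.card := by
    rw [maskFunction_eq, norm_mul, norm_inv, Complex.norm_natCast] at hx
    field_simp at hx
    exact hx
  have hb' : b ∈ B.erase 0 := Finset.mem_erase.2 ⟨hb0, hb⟩
  rw [← Finset.add_sum_erase B _ h0, ← Finset.add_sum_erase _ _ hb', ← add_assoc] at hsum
  have hrest : ‖∑ c ∈ (B.erase 0).erase b, unitExp (c * x)‖ ≤ B.card - 2 := by
    refine (norm_sum_le _ _).trans ?_
    simp only [norm_unitExp, Finset.sum_const, nsmul_eq_mul, mul_one]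
    have h1 := Finset.card_erase_add_one hb'
    have h2 := Finset.card_erase_add_one h0
    have h3 : (((B.erase 0).erase b).card : ℝ) + 2 = B.card := by
      rw [← h2, ← h1]
      push_cast
      ring
    linarith
  set z := unitExp (b * x) with hz
  have hz1 : ‖z‖ = 1 := norm_unitExp _
  have h2 : 2 ≤ ‖1 + z‖ := by
    have := norm_add_le (unitExp (((0 : ℤ) : ℝ) * x) + z)
      (∑ c ∈ (B.erase 0).erase b, unitExp (c * x))
    rw [hsum] at this
    simp only [Int.cast_zero, zero_mul, unitExp_zero] at this
    linarith
  have hn1 : z.re * z.re + z.im * z.im = 1 := by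
    rw [← Complex.normSq_apply, Complex.normSq_eq_norm_sq, hz1, one_pow]
  have hn2 : 4 ≤ (1 + z.re) * (1 + z.re) + z.im * z.im := by
    have h4 : Complex.normSq (1 + z) = (1 + z.re) * (1 + z.re) + z.im * z.im := by
      rw [Complex.normSq_apply]
      simp
    rw [← h4, Complex.normSq_eq_norm_sq]
    nlinarith
  have hre : z.re = 1 := by nlinarith [mul_self_nonneg z.im]
  have him : z.im = 0 := by
    rw [hre] at hn1
    exact mul_self_eq_zero.1 (by linarith)
  exact Complex.ext hre him

/-! ### Orthogonality relations of a Hadamard triple -/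

/-- The orthogonality relations of the rows and columns of the Hadamard matrix, with the
normalization `0 ∈ B ∩ L`. -/
structure HadamardRelations (N : ℕ) (B L : Finset ℤ) : Prop where
  two_le : 2 ≤ N
  card_eq : B.card = L.card
  two_le_card : 2 ≤ B.card
  zero_mem_digits : (0 : ℤ) ∈ B
  zero_mem_dual : (0 : ℤ) ∈ L
  mask_sub : ∀ l ∈ L, ∀ l' ∈ L, l ≠ l' → maskFunction B (((l : ℝ) - l') / N) = 0
  sum_dual : ∀ b ∈ B, ∀ b' ∈ B, b ≠ b' → ∑ l ∈ L, unitExp (((b : ℝ) - b') * l / N) = 0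

theorem hadamardMatrix_apply (N : ℕ) (B L : Finset ℤ) (b : B) (l : L) :
    hadamardMatrix N B L b l =
      (1 / (Real.sqrt (B.card : ℝ) : ℂ)) * unitExp ((b : ℤ) * (l : ℤ) / N) := by
  rw [hadamardMatrix, Matrix.of_apply, unitExp]
  push_cast
  rfl

theorem IsHadamardTriple.relations {N : ℕ} {B L : Finset ℤ} (h : IsHadamardTriple N B L)
    (h0B : (0 : ℤ) ∈ B) (h0L : (0 : ℤ) ∈ L) : HadamardRelations N B L := by
  have hs : (1 / (Real.sqrt (B.card : ℝ) : ℂ)) ≠ 0 := by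
    have : 0 < Real.sqrt (B.card : ℝ) :=
      Real.sqrt_pos.2 (by exact_mod_cast (lt_of_lt_of_le Nat.zero_lt_two h.two_le_card))
    exact one_div_ne_zero (by exact_mod_cast this.ne')
  have hconj : (starRingEnd ℂ) (1 / (Real.sqrt (B.card : ℝ) : ℂ)) =
      1 / (Real.sqrt (B.card : ℝ) : ℂ) := by
    simp [Complex.conj_ofReal]
  have hterm (u v : ℝ) : (1 / (Real.sqrt (B.card : ℝ) : ℂ)) * unitExp u *
      (starRingEnd ℂ) ((1 / (Real.sqrt (B.card : ℝ) : ℂ)) * unitExp v) =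
      (1 / (Real.sqrt (B.card : ℝ) : ℂ)) ^ 2 * unitExp (u - v) := by
    rw [map_mul, hconj, conj_unitExp, sub_eq_add_neg, unitExp_add]
    ring
  refine ⟨h.two_le, h.card_eq, h.two_le_card, h0B, h0L, ?_, ?_⟩
  · intro l hl l' hl' hne
    have h1 := congrFun (congrFun h.conjTranspose_mul ⟨l', hl'⟩) ⟨l, hl⟩
    rw [Matrix.one_apply_ne (by simpa using hne.symm), Matrix.mul_apply] at h1
    simp only [Matrix.conjTranspose_apply, hadamardMatrix_apply, RCLike.star_def] at h1
    simp only [mul_comm ((starRingEnd ℂ) _), hterm] at h1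
    rw [← Finset.mul_sum] at h1
    have h2 := (mul_eq_zero.1 h1).resolve_left (pow_ne_zero _ hs)
    rw [maskFunction_eq, ← Finset.sum_coe_sort B, ← mul_zero ((B.card : ℂ)⁻¹), ← h2]
    congr 1
    refine Finset.sum_congr rfl fun b _ => ?_
    congr 1
    ring
  · intro b hb b' hb' hne
    have h1 := congrFun (congrFun h.mul_conjTranspose ⟨b, hb⟩) ⟨b', hb'⟩
    rw [Matrix.one_apply_ne (by simpa using hne), Matrix.mul_apply] at h1
    simp only [Matrix.conjTranspose_apply, hadamardMatrix_apply, RCLike.star_def, hterm] at h1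
    rw [← Finset.mul_sum] at h1
    have h2 := (mul_eq_zero.1 h1).resolve_left (pow_ne_zero _ hs)
    rw [← Finset.sum_coe_sort L, ← h2]
    refine Finset.sum_congr rfl fun b _ => ?_
    congr 1
    ring

/-! ### Galois conjugation and dilated digit sets. -/

/-- A vanishing sum of `N`-th roots of unity stays zero when all exponents are multiplied by an
integer coprime to `N`. -/
theorem sum_unitExp_mul_eq_zero {ι : Type*} {N t : ℕ} (hN : N ≠ 0) (ht : t.Coprime N)
    (s : Finset ι) (f : ι → ℤ) (h : ∑ i ∈ s, unitExp ((f i : ℝ) / N) = 0) :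
    ∑ i ∈ s, unitExp ((t : ℝ) * f i / N) = 0 := by
  have hN' : (N : ℝ) ≠ 0 := by exact_mod_cast hN
  set ζ : ℂ := unitExp (1 / N) with hζdef
  have hζ : IsPrimitiveRoot ζ N := by
    have := Complex.isPrimitiveRoot_exp N hN
    rw [hζdef, unitExp]
    push_cast
    rwa [mul_one_div]
  have hpow (n : ℕ) : unitExp ((n : ℝ) / N) = ζ ^ n := by
    induction n with
    | zero => simp [unitExp_zero]
    | succ n ih =>
      rw [pow_succ, ← ih, hζdef, ← unitExp_add]
      push_cast
      ring_nf
  have hred (m : ℤ) : unitExp ((m : ℝ) / N) = ζ ^ (m % N).toNat := by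
    have hnn : 0 ≤ m % N := Int.emod_nonneg _ (by exact_mod_cast hN)
    have hm : (m : ℝ) / N = (((m % N).toNat : ℕ) : ℝ) / N + ((m / N : ℤ) : ℝ) := by
      have h1 : (m : ℝ) = ((m % N : ℤ) : ℝ) + N * ((m / N : ℤ) : ℝ) := by
        exact_mod_cast (Int.emod_add_mul_ediv m N).symm
      have h2 : (((m % N).toNat : ℕ) : ℝ) = ((m % N : ℤ) : ℝ) := by
        exact_mod_cast congrArg (Int.cast (R := ℝ)) (Int.toNat_of_nonneg hnn)
      rw [h2]
      field_simp
      linarith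
    rw [hm, unitExp_add, unitExp_intCast, mul_one, hpow]
  have hredt (m : ℤ) : unitExp ((t : ℝ) * m / N) = (ζ ^ t) ^ (m % N).toNat := by
    have hmul (x : ℝ) : unitExp (t * x) = unitExp x ^ t := by
      rw [unitExp, unitExp, ← Complex.exp_nat_mul]
      push_cast
      ring_nf
    rw [mul_div_assoc, hmul, hred, ← pow_mul, ← pow_mul, mul_comm]
  set P : Polynomial ℤ := ∑ i ∈ s, Polynomial.X ^ (f i % N).toNat with hP
  have hroot : Polynomial.aeval ζ P = 0 := by
    rw [hP, map_sum, ← h]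
    refine Finset.sum_congr rfl fun i _ => ?_
    rw [hred, map_pow, Polynomial.aeval_X]
  -- For `t` coprime to `N`, `ζ` and `ζ ^ t` have the same minimal polynomial over `ℤ`, so an
  -- integer polynomial vanishing at `ζ` also vanishes at `ζ ^ t`.
  have hdvd : minpoly ℤ ζ ∣ P :=
    minpoly.isIntegrallyClosed_dvd (hζ.isIntegral (Nat.pos_of_ne_zero hN)) hroot
  rw [hζ.minpoly_eq_pow_coprime ht] at hdvd
  obtain ⟨R, hR⟩ := hdvd
  have hroot' : Polynomial.aeval (ζ ^ t) P = 0 := by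
    rw [hR, map_mul, minpoly.aeval, zero_mul]
  rw [hP, map_sum] at hroot'
  rw [← hroot']
  refine Finset.sum_congr rfl fun i _ => ?_
  rw [hredt, map_pow, Polynomial.aeval_X]

/-- The dilated digit set `tL`. -/
def dilate (t : ℕ) (L : Finset ℤ) : Finset ℤ := L.image fun l => (t : ℤ) * l

theorem mem_dilate {t : ℕ} {L : Finset ℤ} {m : ℤ} :
    m ∈ dilate t L ↔ ∃ l ∈ L, (t : ℤ) * l = m := by
  simp [dilate]

theorem injective_natCast_mul {t : ℕ} (ht0 : t ≠ 0) :
    Function.Injective fun l : ℤ => (t : ℤ) * l :=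
  fun _ _ h => mul_left_cancel₀ (by exact_mod_cast ht0 : (t : ℤ) ≠ 0) h

namespace HadamardRelations

variable {N : ℕ} {B L : Finset ℤ}

theorem nonempty (h : HadamardRelations N B L) : B.Nonempty := ⟨0, h.zero_mem_digits⟩

theorem natCast_pos (h : HadamardRelations N B L) : (0 : ℝ) < N := by
  have := h.two_le
  exact_mod_cast (by omega : 0 < N)

theorem natCast_ne_zero (h : HadamardRelations N B L) : (N : ℝ) ≠ 0 := h.natCast_pos.ne'

/-- Both families of relations are vanishing sums of `N`-th roots of unity, and passing from `L` to
`tL` raises every term to the power `t`. -/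
theorem dilate (h : HadamardRelations N B L) {t : ℕ} (ht0 : t ≠ 0) (ht : t.Coprime N) :
    HadamardRelations N B (dilate t L) := by
  have hN : N ≠ 0 := by have := h.two_le; omega
  have hinj := injective_natCast_mul ht0
  have hcard : (B.card : ℂ)⁻¹ ≠ 0 := inv_ne_zero (by exact_mod_cast h.nonempty.card_pos.ne')
  refine ⟨h.two_le, ?_, h.two_le_card, h.zero_mem_digits, ?_, ?_, ?_⟩
  · rw [CanonicalSpectrum.dilate, Finset.card_image_of_injective _ hinj, h.card_eq]
  · exact mem_dilate.2 ⟨0, h.zero_mem_dual, by simp⟩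
  · intro m hm m' hm' hne
    obtain ⟨l, hl, rfl⟩ := mem_dilate.1 hm
    obtain ⟨l', hl', rfl⟩ := mem_dilate.1 hm'
    have h1 := h.mask_sub l hl l' hl' (fun e => hne (by rw [e]))
    rw [maskFunction_eq] at h1 ⊢
    have h2 := (mul_eq_zero.1 h1).resolve_left hcard
    have h3 := sum_unitExp_mul_eq_zero hN ht B (fun b => b * (l - l')) (by
      rw [← h2]
      refine Finset.sum_congr rfl fun b _ => ?_
      push_cast
      ring_nf)
    refine mul_eq_zero_of_right _ ?_
    rw [← h3]
    refine Finset.sum_congr rfl fun b _ => ?_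
    push_cast
    ring_nf
  · intro b hb b' hb' hne
    have h1 := h.sum_dual b hb b' hb' hne
    have h3 := sum_unitExp_mul_eq_zero hN ht L (fun l => (b - b') * l) (by
      rw [← h1]
      refine Finset.sum_congr rfl fun l _ => ?_
      push_cast
      rfl)
    rw [CanonicalSpectrum.dilate, Finset.sum_image fun _ _ _ _ e => hinj e, ← h3]
    refine Finset.sum_congr rfl fun l _ => ?_
    push_cast
    ring_nf

theorem eq_of_sub_div_mem (h : HadamardRelations N B L) {l l' : ℤ} (hl : l ∈ L) (hl' : l' ∈ L)
    (hmem : ((l : ℝ) - l') / N ∈ periodGroup B) : l = l' := by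
  by_contra hne
  have := h.mask_sub l hl l' hl' hne
  rw [maskFunction_of_mem h.nonempty hmem] at this
  exact one_ne_zero this

/-- The quadrature identity `∑_{ℓ ∈ L} |m_B(τ_ℓ x)|² = 1`. -/
theorem sum_norm_sq_mask (h : HadamardRelations N B L) (x : ℝ) :
    ∑ l ∈ L, ‖maskFunction B (tau N l x)‖ ^ 2 = 1 := by
  have hcard : (B.card : ℂ) ≠ 0 := by exact_mod_cast h.nonempty.card_pos.ne'
  have hN := h.natCast_ne_zero
  have hsq (l : ℤ) : ((‖maskFunction B (tau N l x)‖ ^ 2 : ℝ) : ℂ) =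
      ((B.card : ℂ)⁻¹) ^ 2 * ∑ b ∈ B, ∑ b' ∈ B,
        unitExp (((b : ℝ) - b') * x / N) * unitExp (((b : ℝ) - b') * l / N) := by
    rw [Complex.ofReal_pow, ← Complex.mul_conj', maskFunction_eq, map_mul, map_inv₀,
      Complex.conj_natCast, map_sum, mul_mul_mul_comm, ← sq, Finset.sum_mul_sum]
    congr 1
    refine Finset.sum_congr rfl fun b _ => Finset.sum_congr rfl fun b' _ => ?_
    rw [conj_unitExp, ← unitExp_add, ← unitExp_add, tau]
    congr 1
    field_simp
    ring
  have hC : ((∑ l ∈ L, ‖maskFunction B (tau N l x)‖ ^ 2 : ℝ) : ℂ) = 1 := by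
    rw [Complex.ofReal_sum]
    simp only [hsq]
    rw [← Finset.mul_sum, Finset.sum_comm]
    have hrow : ∀ b ∈ B, ∑ l ∈ L, ∑ b' ∈ B,
        unitExp (((b : ℝ) - b') * x / N) * unitExp (((b : ℝ) - b') * l / N) = B.card := by
      intro b hb
      rw [Finset.sum_comm, Finset.sum_eq_single b]
      · simp [unitExp_zero, h.card_eq]
      · intro b' hb' hne
        rw [← Finset.mul_sum, h.sum_dual b hb b' hb' hne.symm, mul_zero]
      · exact fun hb' => absurd hb hb'
    rw [Finset.sum_congr rfl hrow]
    simp only [Finset.sum_const, nsmul_eq_mul]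
    field_simp
  exact_mod_cast hC

/-- The period group lies in a cyclic group `(1/D)ℤ`. -/
theorem exists_periodGroup_subset (h : HadamardRelations N B L) :
    ∃ D : ℕ, 0 < D ∧ ∀ x ∈ periodGroup B, ∃ n : ℤ, (D : ℝ) * x = n := by
  obtain ⟨b, hb, hb0⟩ : ∃ b ∈ B, b ≠ 0 :=
    Finset.exists_mem_ne (by have := h.two_le_card; omega) 0
  refine ⟨b.natAbs, Int.natAbs_pos.2 hb0, fun x hx => ?_⟩
  obtain ⟨n, hn⟩ := hx b hb
  rcases Int.natAbs_eq b with hb' | hb'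
  · refine ⟨n, ?_⟩
    rw [← hn]
    conv_rhs => rw [hb']
    simp
  · refine ⟨-n, ?_⟩
    rw [Int.cast_neg, ← hn]
    conv_rhs => rw [hb']
    simp

end HadamardRelations


/-! ### Periodic paths of the dual iterated function system -/

/-- `a` is a `K`-periodic sequence with `a (n + 1) = τ_ℓ (a n)` for some `ℓ ∈ L`. -/
structure IsPeriodicPath (N : ℕ) (L : Finset ℤ) (K : ℕ) (a : ℕ → ℝ) : Prop where
  pos : 0 < K
  step : ∀ n, ∃ l ∈ L, tau N l (a n) = a (n + 1)
  periodic : ∀ n, a (n + K) = a n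

theorem IsCycle.exists_path {N : ℕ} {L : Finset ℤ} {C : Set ℝ} (hC : IsCycle N L C) {x : ℝ}
    (hx : x ∈ C) : ∃ K a, IsPeriodicPath N L K a ∧ a 0 = x ∧ ∀ n, a n ∈ C := by
  obtain ⟨k, y, l, rfl, hy⟩ := hC
  obtain ⟨j, rfl⟩ := hx
  refine ⟨k + 1, fun n => y (j + Fin.ofNat (k + 1) n), ⟨k.succ_pos, fun n => ?_, fun n => ?_⟩, ?_,
    fun n => ⟨_, rfl⟩⟩
  · refine ⟨_, (hy _).1, (hy _).2.trans ?_⟩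
    congr 1
    apply Fin.ext
    simp [Fin.val_add, Fin.ofNat, add_assoc]
  · congr 1
    apply Fin.ext
    simp [Fin.val_add, Fin.ofNat]
  · refine congrArg y (Fin.ext ?_)
    simp [Fin.ofNat]

namespace IsPeriodicPath

variable {N : ℕ} {L : Finset ℤ} {K : ℕ} {a : ℕ → ℝ}

theorem periodic_mul (h : IsPeriodicPath N L K a) (n m : ℕ) : a (n + m * K) = a n := by
  induction m with
  | zero => simp
  | succ m ih => rw [Nat.succ_mul, ← add_assoc, h.periodic, ih]

theorem isCycle (h : IsPeriodicPath N L K a) : IsCycle N L (Set.range a) := by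
  obtain ⟨k, rfl⟩ : ∃ k, K = k + 1 := ⟨K - 1, by have := h.pos; omega⟩
  choose l hl using h.step
  have hmod (n : ℕ) : a (n % (k + 1)) = a n := by
    conv_rhs => rw [← Nat.mod_add_div n (k + 1), mul_comm, h.periodic_mul]
  refine ⟨k, fun j => a j, fun j => l j, ?_, fun j => ⟨(hl j).1, (hl j).2.trans ?_⟩⟩
  · ext x
    constructor
    · rintro ⟨n, rfl⟩
      exact ⟨⟨n % (k + 1), Nat.mod_lt _ k.succ_pos⟩, hmod n⟩
    · rintro ⟨j, rfl⟩
      exact ⟨j, rfl⟩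
  · have : ((j + 1 : Fin (k + 1)) : ℕ) = (j + 1) % (k + 1) := by simp [Fin.val_add]
    rw [← hmod, ← this]

/-- Along a path, `a n` and `N ^ j * a (n + j)` differ by an integer. -/
theorem exists_int_eq (h : IsPeriodicPath N L K a) (hN : (N : ℝ) ≠ 0) (n j : ℕ) :
    ∃ z : ℤ, a n = (N : ℝ) ^ j * a (n + j) + z := by
  induction j with
  | zero => exact ⟨0, by simp⟩
  | succ j ih =>
    obtain ⟨z, hz⟩ := ih
    obtain ⟨l, _, hl⟩ := h.step (n + j)
    refine ⟨z - N ^ j * l, ?_⟩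
    rw [hz, ← add_assoc, ← hl, tau]
    push_cast
    field_simp
    ring

/-- By periodicity `a 0` lies ahead of every `a n` on the path, and going backwards multiplies by
powers of `N` and adds integers, which preserves the period group. -/
theorem mem_periodGroup (h : IsPeriodicPath N L K a) (hN : (N : ℝ) ≠ 0) {B : Finset ℤ}
    (h0 : a 0 ∈ periodGroup B) (n : ℕ) : a n ∈ periodGroup B := by
  have hle : n ≤ n * K := Nat.le_mul_of_pos_right n h.pos
  obtain ⟨z, hz⟩ := h.exists_int_eq hN n (n * K - n)
  have hend : a (n + (n * K - n)) = a 0 := by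
    rw [Nat.add_sub_cancel' hle]
    simpa using h.periodic_mul 0 n
  rw [hz, hend]
  refine add_mem ?_ (intCast_mem_periodGroup B z)
  have := natCast_mul_mem_periodGroup (N ^ (n * K - n)) h0
  exact_mod_cast this

theorem isExtremeCycle (h : IsPeriodicPath N L K a) (hN : (N : ℝ) ≠ 0) {B : Finset ℤ}
    (hB : B.Nonempty) (h0 : a 0 ∈ periodGroup B) : IsExtremeCycle N B L (Set.range a) := by
  refine ⟨h.isCycle, ?_⟩
  rintro _ ⟨n, rfl⟩
  rw [maskFunction_of_mem hB (h.mem_periodGroup hN h0 n), norm_one]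

theorem mul (h : IsPeriodicPath N L K a) (t : ℕ) :
    IsPeriodicPath N (dilate t L) K fun n => t * a n := by
  refine ⟨h.pos, fun n => ?_, fun n => by rw [h.periodic]⟩
  obtain ⟨l, hl, he⟩ := h.step n
  refine ⟨t * l, mem_dilate.2 ⟨l, hl, rfl⟩, ?_⟩
  rw [← he, tau, tau]
  push_cast
  ring

theorem div {t : ℕ} (ht : t ≠ 0) (h : IsPeriodicPath N (dilate t L) K a) :
    IsPeriodicPath N L K fun n => a n / t := by
  have ht' : (t : ℝ) ≠ 0 := by exact_mod_cast ht
  refine ⟨h.pos, fun n => ?_, fun n => by rw [h.periodic]⟩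
  obtain ⟨m, hm, he⟩ := h.step n
  obtain ⟨l, hl, rfl⟩ := mem_dilate.1 hm
  refine ⟨l, hl, ?_⟩
  rw [← he, tau, tau]
  push_cast
  field_simp

end IsPeriodicPath

/-! ### Structure of the canonical spectrum -/

theorem mul_add_mem_canonicalSpectrum {N : ℕ} {B L : Finset ℤ} {x : ℝ}
    (hx : x ∈ canonicalSpectrum N B L) {l : ℤ} (hl : l ∈ L) :
    (N : ℝ) * x + l ∈ canonicalSpectrum N B L :=
  Set.mem_sInter.2 fun S hS => hS.2 x (Set.mem_sInter.1 hx S hS) l hl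

theorem neg_mem_canonicalSpectrum {N : ℕ} {B L : Finset ℤ} {C : Set ℝ}
    (hC : IsExtremeCycle N B L C) {x : ℝ} (hx : x ∈ C) : -x ∈ canonicalSpectrum N B L :=
  Set.mem_sInter.2 fun _ hS => hS.1 C hC (Set.neg_mem_neg.2 hx)

theorem canonicalSpectrum_subset {N : ℕ} {B L : Finset ℤ} {S : Set ℝ}
    (h1 : ∀ C, IsExtremeCycle N B L C → ∀ x ∈ C, -x ∈ S)
    (h2 : ∀ x ∈ S, ∀ l ∈ L, (N : ℝ) * x + (l : ℝ) ∈ S) : canonicalSpectrum N B L ⊆ S :=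
  Set.sInter_subset_of_mem
    ⟨fun C hC x hx => by simpa using h1 C hC (-x) (Set.mem_neg.1 hx), h2⟩

/-- This makes every frequency a period of `m_B`, so only the last digit `ℓ` of `Nλ + ℓ` matters
when the mask is evaluated. -/
theorem canonicalSpectrum_subset_periodGroup {N : ℕ} {B : Finset ℤ} (L : Finset ℤ)
    (h0 : (0 : ℤ) ∈ B) : canonicalSpectrum N B L ⊆ periodGroup B := by
  refine canonicalSpectrum_subset (fun C hC x hx => ?_) fun x hx l _ => ?_
  · exact neg_mem (mem_periodGroup_of_norm_maskFunction h0 (hC.2 x hx))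
  · exact add_mem (natCast_mul_mem_periodGroup N hx) (intCast_mem_periodGroup B l)

namespace HadamardRelations

variable {N : ℕ} {B L : Finset ℤ}

theorem neg_mem_canonicalSpectrum_of_path (h : HadamardRelations N B L) {K : ℕ} {a : ℕ → ℝ}
    (ha : IsPeriodicPath N L K a) (h0 : a 0 ∈ periodGroup B) :
    -a 0 ∈ canonicalSpectrum N B L :=
  neg_mem_canonicalSpectrum (ha.isExtremeCycle h.natCast_ne_zero h.nonempty h0) ⟨0, rfl⟩

theorem zero_mem_canonicalSpectrum (h : HadamardRelations N B L) :
    (0 : ℝ) ∈ canonicalSpectrum N B L := by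
  have hp : IsPeriodicPath N L 1 fun _ => 0 :=
    ⟨one_pos, fun _ => ⟨0, h.zero_mem_dual, by simp [tau]⟩, fun _ => rfl⟩
  simpa using h.neg_mem_canonicalSpectrum_of_path hp (zero_mem _)

/-- By minimality it suffices that the frequencies with a predecessor satisfy the two closure
properties. A cycle point supplies one because `a 1 = (a 0 + l) / N` rewrites as `-a 0 = N * (-a 1)
+ l`. -/
theorem exists_eq_mul_add (h : HadamardRelations N B L) {x : ℝ}
    (hx : x ∈ canonicalSpectrum N B L) :
    ∃ y ∈ canonicalSpectrum N B L, ∃ l ∈ L, x = N * y + l := by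
  have hN := h.natCast_ne_zero
  have hsub : canonicalSpectrum N B L ⊆ {x | x ∈ canonicalSpectrum N B L ∧
      ∃ y ∈ canonicalSpectrum N B L, ∃ l ∈ L, x = N * y + l} := by
    refine canonicalSpectrum_subset (fun C hC x hx => ⟨neg_mem_canonicalSpectrum hC hx, ?_⟩)
      fun x hx l hl => ⟨mul_add_mem_canonicalSpectrum hx.1 hl, x, hx.1, l, hl, rfl⟩
    obtain ⟨K, a, ha, rfl, haC⟩ := hC.1.exists_path hx
    obtain ⟨l, hl, he⟩ := ha.step 0
    refine ⟨-a 1, neg_mem_canonicalSpectrum hC (haC 1), l, hl, ?_⟩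
    rw [zero_add] at he
    rw [← he, tau]
    field_simp
    ring
  exact (hsub hx).2

theorem mul_add_injective (h : HadamardRelations N B L) {x x' : ℝ}
    (hx : x ∈ periodGroup B) (hx' : x' ∈ periodGroup B) {l l' : ℤ}
    (hl : l ∈ L) (hl' : l' ∈ L) (he : (N : ℝ) * x + l = N * x' + l') : l = l' ∧ x = x' := by
  have hN := h.natCast_ne_zero
  have hll : l = l' := by
    refine h.eq_of_sub_div_mem hl hl' ?_
    have : ((l : ℝ) - l') / N = x' - x := by
      field_simp
      linarith
    rw [this]
    exact sub_mem hx' hx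
  refine ⟨hll, ?_⟩
  subst hll
  exact mul_left_cancel₀ hN (by linarith)

theorem countable_canonicalSpectrum (h : HadamardRelations N B L) :
    (canonicalSpectrum N B L).Countable := by
  obtain ⟨D, hD, hsub⟩ := h.exists_periodGroup_subset
  have hD' : (D : ℝ) ≠ 0 := by exact_mod_cast hD.ne'
  refine (Set.countable_range fun n : ℤ => (n : ℝ) / D).mono fun x hx => ?_
  obtain ⟨n, hn⟩ := hsub x (canonicalSpectrum_subset_periodGroup L h.zero_mem_digits hx)
  exact ⟨n, by simp only [← hn]; field_simp⟩

end HadamardRelations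

/-! ### The Fourier transform of the self-similar measure -/

/-- `fourierMeasure μ t = ∫ e^{2πitx} dμ(x)`. -/
def fourierMeasure (μ : Measure ℝ) (t : ℝ) : ℂ := ∫ x, unitExp (t * x) ∂μ

theorem integrable_unitExp_mul (μ : Measure ℝ) [IsFiniteMeasure μ] (t : ℝ) :
    Integrable (fun x => unitExp (t * x)) μ :=
  Integrable.of_bound (C := 1)
    (continuous_unitExp.comp (continuous_const.mul continuous_id)).aestronglyMeasurable
    (Filter.Eventually.of_forall fun _ => (norm_unitExp _).le)

theorem fourierMeasure_zero (μ : Measure ℝ) [IsProbabilityMeasure μ] : fourierMeasure μ 0 = 1 := by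
  simp [fourierMeasure, unitExp_zero]

theorem conj_fourierMeasure (μ : Measure ℝ) (t : ℝ) :
    (starRingEnd ℂ) (fourierMeasure μ t) = fourierMeasure μ (-t) := by
  rw [fourierMeasure, fourierMeasure, ← integral_conj]
  simp [conj_unitExp]

theorem norm_fourierMeasure_neg (μ : Measure ℝ) (t : ℝ) :
    ‖fourierMeasure μ (-t)‖ = ‖fourierMeasure μ t‖ := by
  rw [← conj_fourierMeasure, RCLike.norm_conj]

theorem IsSelfSimilarMeasure.fourierMeasure_eq {N : ℕ} {B : Finset ℤ} {μ : Measure ℝ}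
    (hμ : IsSelfSimilarMeasure N B μ) (t : ℝ) :
    fourierMeasure μ t = maskFunction B (t / N) * fourierMeasure μ (t / N) := by
  have := hμ.isProbabilityMeasure
  have hint (b : ℤ) : Integrable (fun x => unitExp (t * x)) (μ.map (tau N b)) := by
    have := Measure.isProbabilityMeasure_map (μ := μ) (measurable_tau N b).aemeasurable
    exact integrable_unitExp_mul _ t
  rw [fourierMeasure]
  conv_lhs => rw [hμ.eq_sum]
  rw [integral_smul_measure, integral_finsetSum_measure fun b _ => hint b, maskFunction_eq,
    mul_assoc, Finset.sum_mul]
  have hc : ((B.card : ℝ≥0∞)⁻¹).toReal = (B.card : ℝ)⁻¹ := by simp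
  rw [hc, Complex.real_smul]
  push_cast
  congr 1
  refine Finset.sum_congr rfl fun b _ => ?_
  rw [integral_map (measurable_tau N b).aemeasurable (hint b).aestronglyMeasurable,
    fourierMeasure, ← integral_const_mul]
  refine integral_congr_ae (Filter.Eventually.of_forall fun x => ?_)
  simp only [tau]
  rw [← unitExp_add]
  congr 1
  ring

/-- Distinct frequencies of the canonical spectrum are orthogonal. -/
theorem HadamardRelations.fourierMeasure_sub_eq_zero {N : ℕ} {B L : Finset ℤ}
    (h : HadamardRelations N B L) {μ : Measure ℝ} (hμ : IsSelfSimilarMeasure N B μ) {x y : ℝ}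
    (hx : x ∈ canonicalSpectrum N B L) (hy : y ∈ canonicalSpectrum N B L) (hne : x ≠ y) :
    fourierMeasure μ (x - y) = 0 := by
  have hN := h.natCast_ne_zero
  have hsub := canonicalSpectrum_subset_periodGroup (N := N) L h.zero_mem_digits
  obtain ⟨D, hD, hDint⟩ := h.exists_periodGroup_subset
  have hD' : (D : ℝ) ≠ 0 := by exact_mod_cast hD.ne'
  -- Induction on the integer `|D(x - y)|`, removing the last digits. Equal digits divide the
  -- difference by `N`; distinct digits give a zero of the mask, since `x' - y'` is a period.
  have key : ∀ n : ℕ, ∀ x ∈ canonicalSpectrum N B L, ∀ y ∈ canonicalSpectrum N B L, x ≠ y →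
      ∀ z : ℤ, (D : ℝ) * (x - y) = z → z.natAbs = n → fourierMeasure μ (x - y) = 0 := by
    intro n
    induction n using Nat.strong_induction_on with
    | _ n ih =>
      intro x hx y hy hne z hz hn
      obtain ⟨x', hx', l, hl, rfl⟩ := h.exists_eq_mul_add hx
      obtain ⟨y', hy', l', hl', rfl⟩ := h.exists_eq_mul_add hy
      have hdiff := sub_mem (hsub hx') (hsub hy')
      rw [hμ.fourierMeasure_eq]
      by_cases hll : l = l'
      · subst hll
        have he : ((N : ℝ) * x' + l - (N * y' + l)) / N = x' - y' := by
          field_simp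
          ring
        have hne' : x' ≠ y' := fun e => hne (by rw [e])
        obtain ⟨w, hw⟩ := hDint _ hdiff
        have hzw : z = N * w := by
          have : (z : ℝ) = N * w := by
            rw [← hz, ← hw]
            ring
          exact_mod_cast this
        have hw0 : w ≠ 0 := by
          rintro rfl
          rw [Int.cast_zero, mul_eq_zero, or_iff_right hD', sub_eq_zero] at hw
          exact hne' hw
        have hlt : w.natAbs < n := by
          rw [← hn, hzw, Int.natAbs_mul, Int.natAbs_natCast]
          have h1 := h.two_le
          have h2 := Int.natAbs_pos.2 hw0
          nlinarith
        rw [he, ih _ hlt x' hx' y' hy' hne' w hw rfl, mul_zero]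
      · have he : ((N : ℝ) * x' + l - (N * y' + l')) / N = ((l : ℝ) - l') / N + (x' - y') := by
          field_simp
          ring
        rw [he, maskFunction_add_of_mem _ hdiff, h.mask_sub l hl l' hl' hll, zero_mul]
  obtain ⟨z, hz⟩ := hDint _ (sub_mem (hsub hx) (hsub hy))
  exact key _ x hx y hy hne z hz rfl


/-! ### Counting periodic points with a given denominator -/

/-- If `q` divides a power of `P` and `N ^ r - 1`, then `q` is at most proportional to `r`. -/
theorem dvd_totient_pow_sub_one_mul {N P q r m : ℕ} (hN : 2 ≤ N) (hP0 : P ≠ 0)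
    (hcop : P.Coprime N) (hqP : q ∣ P ^ m) (hr : r ≠ 0) (hq : q ∣ N ^ r - 1) :
    q ∣ (N ^ (2 * P.totient) - 1) * r := by
  have hφ : 0 < P.totient := Nat.totient_pos.2 (Nat.pos_of_ne_zero hP0)
  set x := N ^ P.totient with hx
  have hx1 : 1 < x := Nat.one_lt_pow hφ.ne' (by omega)
  have hPx : P ∣ x - 1 :=
    (Nat.modEq_iff_dvd' hx1.le).1 (Nat.ModEq.pow_totient hcop.symm).symm
  have hx2 : 1 < x ^ 2 := Nat.one_lt_pow two_ne_zero hx1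
  have hNx : N ^ (2 * P.totient) = x ^ 2 := by rw [hx, ← pow_mul, mul_comm]
  have hq0 : q ≠ 0 := fun e => by
    rw [e, zero_dvd_iff] at hqP
    exact pow_ne_zero m hP0 hqP
  have hM : x ^ (2 * r) - 1 ≠ 0 :=
    Nat.sub_ne_zero_of_lt (Nat.one_lt_pow (by omega) hx1)
  have hqM : q ∣ x ^ (2 * r) - 1 := by
    refine hq.trans ?_
    have := Nat.sub_dvd_pow_sub_pow (N ^ r) 1 (2 * P.totient)
    rw [one_pow, ← pow_mul] at this
    have he : x ^ (2 * r) = N ^ (r * (2 * P.totient)) := by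
      rw [hx, ← pow_mul]
      ring_nf
    rwa [he]
  rw [hNx]
  have hx20 : x ^ 2 - 1 ≠ 0 := Nat.sub_ne_zero_of_lt hx2
  refine (Nat.factorization_prime_le_iff_dvd hq0 (mul_ne_zero hx20 hr)).1 fun p hp => ?_
  by_cases hpq : p ∣ q
  swap
  · rw [Nat.factorization_eq_zero_of_not_dvd hpq]
    exact Nat.zero_le _
  have : Fact p.Prime := ⟨hp⟩
  have hpP : p ∣ P := hp.dvd_of_dvd_pow (hpq.trans hqP)
  have hpx : p ∣ x - 1 := hpP.trans hPx
  have hpnx : ¬p ∣ x := fun hd =>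
    hp.one_lt.ne' (Nat.dvd_one.1 ((Nat.dvd_sub_iff_right hx1.le hd).1 hpx))
  refine ((Nat.factorization_prime_le_iff_dvd hq0 hM).2 hqM p hp).trans ?_
  rw [Nat.factorization_def _ hp, Nat.factorization_def _ hp, padicValNat.mul hx20 hr]
  -- The factor `2` in the exponent serves `p = 2`: lifting the exponent there needs an even power,
  -- and `v₂(x ^ (2r) - 1) = v₂(x ^ 2 - 1) + v₂(r)` then has the same shape as for odd `p`.
  rcases hp.eq_two_or_odd' with rfl | hodd
  · have h1 := padicValNat.pow_two_sub_pow hx1 hpx hpnx (n := 2 * r) (by omega) (even_two_mul r)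
    rw [one_pow, padicValNat.mul two_ne_zero hr, padicValNat_self] at h1
    have h2 : x ^ 2 - 1 = (x + 1) * (x - 1) := by simpa using Nat.sq_sub_sq x 1
    rw [h2, padicValNat.mul (by omega) (by omega)]
    omega
  · have h1 := padicValNat.pow_sub_pow hodd hx2
      (hpx.trans (by simpa using Nat.sub_dvd_pow_sub_pow x 1 2))
      (fun hd => hpnx (hp.dvd_of_dvd_pow hd)) hr
    rw [one_pow, ← pow_mul] at h1
    exact h1.le

namespace IsPeriodicPath

variable {N : ℕ} {L : Finset ℤ} {K : ℕ} {a : ℕ → ℝ}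

theorem abs_le (h : IsPeriodicPath N L K a) (hN : 2 ≤ N) {R : ℝ}
    (hR : ∀ l ∈ L, |(l : ℝ)| ≤ R) (n : ℕ) : |a n| ≤ R := by
  have hN' : (2 : ℝ) ≤ N := by exact_mod_cast hN
  have hR0 : 0 ≤ R := by
    obtain ⟨l, hl, _⟩ := h.step 0
    exact (abs_nonneg _).trans (hR l hl)
  have hstep (j : ℕ) : |a (j + 1)| ≤ (|a j| + R) / 2 := by
    obtain ⟨l, hl, he⟩ := h.step j
    rw [← he, tau, abs_div, abs_of_pos (by linarith : (0 : ℝ) < N)]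
    have h1 : |a j + l| ≤ |a j| + R := (abs_add_le _ _).trans (by linarith [hR l hl])
    exact (div_le_div_of_nonneg_right h1 (by linarith)).trans
      (div_le_div_of_nonneg_left (by positivity) two_pos hN')
  -- Each step at least halves the excess over `R`; after a full period it must return to itself, so
  -- it cannot be positive.
  have hpow (j : ℕ) : (|a (n + j)| - R) * 2 ^ j ≤ |a n| - R := by
    induction j with
    | zero => simp
    | succ j ih =>
      refine le_trans ?_ ih
      rw [pow_succ, ← add_assoc]
      have h1 := hstep (n + j)
      have h2 : (0 : ℝ) < 2 ^ j := by positivity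
      nlinarith
  have hK := hpow K
  rw [h.periodic] at hK
  have h2 : (2 : ℝ) ≤ 2 ^ K := by
    calc (2 : ℝ) = 2 ^ 1 := (pow_one 2).symm
      _ ≤ 2 ^ K := pow_le_pow_right₀ one_le_two h.pos
  by_contra hlt
  push Not at hlt
  nlinarith

/-- A stretch of a path whose points are distinct and lie in `(1/M)ℤ` with `M ≤ D * N ^ k` has
at most `(#L) ^ k * (2 * D * R + 2)` points. -/
theorem length_le (h : IsPeriodicPath N L K a) (hN : 2 ≤ N) {R D k M r : ℕ}
    (hR : ∀ l ∈ L, |(l : ℝ)| ≤ R) (hM : M ≤ D * N ^ k)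
    (hint : ∀ n, ∃ z : ℤ, (M : ℝ) * a n = z) (hM0 : M ≠ 0)
    (hinj : ∀ i < r, ∀ j < r, a (i + k) = a (j + k) → i = j) :
    r ≤ L.card ^ k * (2 * (D * R) + 2) := by
  have hNpos : (0 : ℝ) < N := by exact_mod_cast (by omega : 0 < N)
  choose l hl he using h.step
  choose z hz using hint
  -- `S w` is the image of `0` after `k` steps with digits `w`, so a point `k` steps later is `S w`
  -- plus the old point divided by `N ^ k`.
  let S : (Fin k → L) → ℝ := fun w => ∑ i : Fin k, ((w i : ℤ) : ℝ) / (N : ℝ) ^ (k - i)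
  let word : ℕ → Fin k → L := fun n i => ⟨l (n + i), hl _⟩
  have hexp (n : ℕ) : a (n + k) = a n / (N : ℝ) ^ k + S (word n) := by
    have hgen (j : ℕ) : a (n + j) = a n / (N : ℝ) ^ j +
        ∑ i ∈ Finset.range j, (l (n + i) : ℝ) / (N : ℝ) ^ (j - i) := by
      induction j with
      | zero => simp
      | succ j ih =>
        rw [← add_assoc, ← he, tau, ih, Finset.sum_range_succ, add_div, add_div, Finset.sum_div,
          add_assoc]
        congr 1
        · rw [div_div, pow_succ]
        · congr 1
          · refine Finset.sum_congr rfl fun i hi => ?_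
            have := Finset.mem_range.1 hi
            rw [div_div, ← pow_succ]
            congr 2
            omega
          · simp
    rw [hgen k, Finset.sum_range]
  -- The contribution of the old point to `M * a (n + k)` is at most `D * R`, because `M ≤ D * N ^
  -- k`. The digits thus leave only `2 * D * R + 2` values for this integer, the floor accounting
  -- for one extra value.
  have hbound (n : ℕ) :
      z (n + k) - ⌊(M : ℝ) * S (word n)⌋ ∈ Finset.Icc (-((D * R : ℕ) : ℤ)) ((D * R : ℕ) + 1) := by
    have hsmall : |(M : ℝ) * (a n / (N : ℝ) ^ k)| ≤ ((D * R : ℕ) : ℝ) := by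
      rw [abs_mul, abs_div, Nat.abs_cast, abs_of_pos (pow_pos hNpos k)]
      have h1 := h.abs_le hN hR n
      have h2 : (M : ℝ) ≤ D * N ^ k := by exact_mod_cast hM
      calc (M : ℝ) * (|a n| / N ^ k) ≤ (D * N ^ k) * (R / N ^ k) := by gcongr
        _ = ((D * R : ℕ) : ℝ) := by
          push_cast
          field_simp
    have hsum : (z (n + k) : ℝ) = (M : ℝ) * (a n / (N : ℝ) ^ k) + M * S (word n) := by
      rw [← hz, hexp n]
      ring
    have h3 := Int.floor_le ((M : ℝ) * S (word n))
    have h4 := Int.lt_floor_add_one ((M : ℝ) * S (word n))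
    rw [_root_.abs_le] at hsmall
    rw [Finset.mem_Icc]
    constructor
    · have : (-((D * R : ℕ) : ℝ)) ≤ (z (n + k) : ℝ) - ⌊(M : ℝ) * S (word n)⌋ := by linarith
      exact_mod_cast this
    · have : (z (n + k) : ℝ) - ⌊(M : ℝ) * S (word n)⌋ ≤ ((D * R : ℕ) : ℝ) + 1 := by linarith
      exact_mod_cast this
  let f : Fin r → (Fin k → L) × Finset.Icc (-((D * R : ℕ) : ℤ)) ((D * R : ℕ) + 1) :=
    fun i => (word i, ⟨_, hbound i⟩)
  have hf : Function.Injective f := by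
    intro i j hij
    have h1 : word i = word j := congrArg Prod.fst hij
    have h2 : z (i + k) - ⌊(M : ℝ) * S (word i)⌋ = z (j + k) - ⌊(M : ℝ) * S (word j)⌋ :=
      congrArg Subtype.val (congrArg Prod.snd hij)
    rw [h1, sub_left_inj] at h2
    refine Fin.ext (hinj i i.2 j j.2 ?_)
    have hM' : (M : ℝ) ≠ 0 := by exact_mod_cast hM0
    refine mul_left_cancel₀ hM' ?_
    rw [hz, hz, h2]
  have hcard := Fintype.card_le_of_injective f hf
  simp only [Fintype.card_fin, Fintype.card_prod, Fintype.card_fun, Fintype.card_coe,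
    Int.card_Icc] at hcard
  refine hcard.trans (Nat.mul_le_mul_left _ ?_)
  omega

end IsPeriodicPath

/-- The order modulo the period group serves as a reduced denominator of `x`. -/
theorem addOrderOf_mk_dvd_iff {B : Finset ℤ} {x : ℝ} {n : ℕ} :
    addOrderOf (QuotientAddGroup.mk x : ℝ ⧸ periodGroup B) ∣ n ↔
      (n : ℝ) * x ∈ periodGroup B := by
  rw [addOrderOf_dvd_iff_nsmul_eq_zero, ← QuotientAddGroup.mk_nsmul, QuotientAddGroup.eq_zero_iff,
    nsmul_eq_mul]

theorem exists_bound_of_le_mul_pow {N c : ℕ} (hc : c < N) (A : ℕ) :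
    ∃ k₀ : ℕ, ∀ k, N ^ k ≤ A * c ^ k → k ≤ k₀ := by
  have hN : (0 : ℝ) < N := by exact_mod_cast (by omega : 0 < N)
  have hlt : (c : ℝ) / N < 1 := (div_lt_one hN).2 (by exact_mod_cast hc)
  obtain ⟨k₀, hk₀⟩ := exists_pow_lt_of_lt_one (by positivity : (0 : ℝ) < 1 / (A + 1)) hlt
  refine ⟨k₀, fun k hk => ?_⟩
  by_contra hgt
  push Not at hgt
  have h1 : ((c : ℝ) / N) ^ k < 1 / (A + 1) :=
    (pow_le_pow_of_le_one (by positivity) hlt.le hgt.le).trans_lt hk₀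
  rw [div_pow, div_lt_div_iff₀ (by positivity) (by positivity)] at h1
  have h2 : (N : ℝ) ^ k ≤ A * c ^ k := by exact_mod_cast hk
  have h3 : (0 : ℝ) ≤ (c : ℝ) ^ k := by positivity
  nlinarith

namespace HadamardRelations

variable {N : ℕ} {B L : Finset ℤ}

/-- Periodic points whose denominator relative to the period group is composed of prime factors
of `P` have bounded denominators. -/
theorem exists_addOrderOf_le (h : HadamardRelations N B L) (hlt : B.card < N) {P : ℕ}
    (hP0 : P ≠ 0) (hcop : P.Coprime N) :
    ∃ Q : ℕ, ∀ K a, IsPeriodicPath N L K a → ∀ m,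
      addOrderOf (QuotientAddGroup.mk (a 0) : ℝ ⧸ periodGroup B) ∣ P ^ m →
      addOrderOf (QuotientAddGroup.mk (a 0) : ℝ ⧸ periodGroup B) ≤ Q := by
  have hN := h.two_le
  have hN0 := h.natCast_ne_zero
  obtain ⟨D, hD, hDint⟩ := h.exists_periodGroup_subset
  obtain ⟨R, hR⟩ : ∃ R : ℕ, ∀ l ∈ L, |(l : ℝ)| ≤ R := by
    refine ⟨∑ l ∈ L, l.natAbs, fun l hl => ?_⟩
    have := Finset.single_le_sum (f := fun l : ℤ => l.natAbs) (fun _ _ => Nat.zero_le _) hl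
    rw [← Int.cast_abs, ← Nat.cast_natAbs]
    exact_mod_cast this
  set c := (N ^ (2 * P.totient) - 1) * (2 * (D * R) + 2) with hc
  obtain ⟨k₀, hk₀⟩ := exists_bound_of_le_mul_pow (h.card_eq ▸ hlt) (N * c)
  refine ⟨N ^ k₀, fun K a ha m hm => ?_⟩
  set q := addOrderOf (QuotientAddGroup.mk (a 0) : ℝ ⧸ periodGroup B) with hq
  have hq0 : q ≠ 0 := fun e => by
    rw [e, zero_dvd_iff] at hm
    exact pow_ne_zero m hP0 hm
  -- The bound `N ^ (k - 1) < q` used below requires `q > 1`.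
  by_cases hq1 : q ≤ 1
  · exact hq1.trans (Nat.one_le_pow _ _ (by omega))
  have hcast (r : ℕ) : ((N ^ r - 1 : ℕ) : ℝ) = (N : ℝ) ^ r - 1 := by
    rw [Nat.cast_sub (Nat.one_le_pow _ _ (by omega))]
    push_cast
    rfl
  have hex : ∃ r : ℕ, 0 < r ∧ ((N ^ r - 1 : ℕ) : ℝ) * a 0 ∈ periodGroup B := by
    refine ⟨K, ha.pos, ?_⟩
    obtain ⟨z, hz⟩ := ha.exists_int_eq hN0 0 K
    have hper := ha.periodic 0
    rw [hper] at hz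
    have : ((N ^ K - 1 : ℕ) : ℝ) * a 0 = ((-z : ℤ) : ℝ) := by
      rw [hcast]
      push_cast
      linarith
    rw [this]
    exact intCast_mem_periodGroup B _
  classical
  set r := Nat.find hex with hr
  obtain ⟨hr0, hrmem⟩ := Nat.find_spec hex
  rw [← hr] at hr0 hrmem
  have hdvd := dvd_totient_pow_sub_one_mul hN hP0 hcop hm hr0.ne' (addOrderOf_mk_dvd_iff.2 hrmem)
  set k := Nat.clog N q with hk
  have hqk : q ≤ N ^ k := Nat.le_pow_clog (by omega) q
  have hqmem (n : ℕ) : (q : ℝ) * a n ∈ periodGroup B := by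
    have hp := ha.mul q
    exact hp.mem_periodGroup hN0 (addOrderOf_mk_dvd_iff.1 dvd_rfl) n
  have hlen : r ≤ L.card ^ k * (2 * (D * R) + 2) := by
    refine ha.length_le hN (M := D * q) hR (Nat.mul_le_mul_left D hqk) (fun n => ?_)
      (mul_ne_zero hD.ne' hq0) ?_
    · obtain ⟨z, hz⟩ := hDint _ (hqmem n)
      exact ⟨z, by rw [← hz]; push_cast; ring⟩
    -- A coincidence makes `(N ^ (j - i) - 1) * a (j + k)` an integer. Since `a 0` is `N ^ (j + k) *
    -- a (j + k)` plus an integer, `(N ^ (j - i) - 1) * a 0` is an integer too, against the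
    -- minimality of `r`.
    · have hlt_ne : ∀ i j, i < j → j < r → a (i + k) ≠ a (j + k) := by
        intro i j hij hj he
        refine Nat.find_min hex (m := j - i) (by omega) ⟨by omega, ?_⟩
        obtain ⟨z, hz⟩ := ha.exists_int_eq hN0 (i + k) (j - i)
        obtain ⟨w, hw⟩ := ha.exists_int_eq hN0 0 (j + k)
        have hidx : i + k + (j - i) = j + k := by omega
        rw [hidx, he] at hz
        rw [zero_add] at hw
        have hval : ((N ^ (j - i) - 1 : ℕ) : ℝ) * a 0 =
            ((-(N ^ (j + k) * z) + ((N ^ (j - i) : ℤ) - 1) * w : ℤ) : ℝ) := by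
          rw [hcast, hw]
          push_cast
          linear_combination (-(N : ℝ) ^ (j + k)) * hz
        rw [hval]
        exact intCast_mem_periodGroup B _
      intro i hi j hj he
      rcases lt_trichotomy i j with hij | hij | hij
      · exact absurd he (hlt_ne i j hij hj)
      · exact hij
      · exact absurd he.symm (hlt_ne j i hij hi)
  have hA0 : 0 < N ^ (2 * P.totient) - 1 := by
    have hφ : 0 < P.totient := Nat.totient_pos.2 (Nat.pos_of_ne_zero hP0)
    exact Nat.sub_pos_of_lt (Nat.one_lt_pow (by omega) (by omega))
  have hqle : q ≤ c * L.card ^ k := by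
    refine (Nat.le_of_dvd (Nat.mul_pos hA0 hr0) hdvd).trans ?_
    rw [hc, mul_assoc, mul_comm (2 * (D * R) + 2)]
    exact Nat.mul_le_mul_left _ hlen
  have hpred : N ^ (k - 1) < q := Nat.pow_pred_clog_lt_self (by omega) (by omega)
  have hk1 : 0 < k := Nat.clog_pos (by omega) (by omega)
  have hkk₀ : k ≤ k₀ := by
    refine hk₀ k ?_
    calc N ^ k = N * N ^ (k - 1) := by rw [← pow_succ', Nat.sub_add_cancel hk1]
      _ ≤ N * (c * L.card ^ k) := Nat.mul_le_mul_left _ (hpred.le.trans hqle)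
      _ = N * c * L.card ^ k := by ring
  exact hqk.trans (Nat.pow_le_pow_right (by omega) hkk₀)

end HadamardRelations

/-! ### Saturated multipliers. -/

/-- A periodic point of the dual system that `t` maps into the period group already lies in it. -/
def IsSaturatedAt (N : ℕ) (B L : Finset ℤ) (t : ℕ) : Prop :=
  ∀ K a, IsPeriodicPath N L K a → (t : ℝ) * a 0 ∈ periodGroup B → a 0 ∈ periodGroup B

/-- Every prime exponent in `q` is smaller than `q`, so the unknown exponent `m` can be replaced by
`q`. This makes a bound on `q` a bound on the power of `P` that is needed. -/
theorem dvd_pow_self_of_dvd_pow {P q m : ℕ} (hP0 : P ≠ 0) (h : q ∣ P ^ m) : q ∣ P ^ q := by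
  have hq0 : q ≠ 0 := fun e => by
    rw [e, zero_dvd_iff] at h
    exact pow_ne_zero m hP0 h
  refine (Nat.factorization_prime_le_iff_dvd hq0 (pow_ne_zero q hP0)).1 fun p hp => ?_
  by_cases hpq : p ∣ q
  swap
  · rw [Nat.factorization_eq_zero_of_not_dvd hpq]
    exact Nat.zero_le _
  have hpP : p ∣ P := hp.dvd_of_dvd_pow (hpq.trans h)
  rw [Nat.factorization_pow, Finsupp.smul_apply, smul_eq_mul]
  exact (Nat.factorization_lt p hq0).le.trans
    (Nat.le_mul_of_pos_right _ (hp.factorization_pos_of_dvd hP0 hpP))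

theorem HadamardRelations.exists_saturated {N : ℕ} {B L : Finset ℤ}
    (h : HadamardRelations N B L) (hlt : B.card < N) {P : ℕ} (hP0 : P ≠ 0)
    (hcop : P.Coprime N) : ∃ n₀ : ℕ, ∀ n ≥ n₀, IsSaturatedAt N B L (P ^ n) →
      ∀ t m, t ∣ P ^ m → IsSaturatedAt N B L t := by
  obtain ⟨Q, hQ⟩ := h.exists_addOrderOf_le hlt hP0 hcop
  refine ⟨Q, fun n hn hsat t m htm K a ha hta => hsat K a ha ?_⟩
  have hdvd := (addOrderOf_mk_dvd_iff.2 hta).trans htm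
  refine addOrderOf_mk_dvd_iff.1 ((dvd_pow_self_of_dvd_pow hP0 hdvd).trans ?_)
  exact pow_dvd_pow P ((hQ K a ha m hdvd).trans hn)


/-! ### Exponentials in `L²(μ)` -/

/-- The exponential `x ↦ e^{2πitx}` as a bounded continuous function. -/
def expBounded (t : ℝ) : BoundedContinuousFunction ℝ ℂ :=
  BoundedContinuousFunction.ofNormedAddCommGroup (fun x => unitExp (t * x))
    (continuous_unitExp.comp (continuous_const.mul continuous_id)) 1 fun _ => (norm_unitExp _).le

/-- The exponential `x ↦ e^{2πitx}` as an element of `L²(μ)`. -/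
def expLp (μ : Measure ℝ) [IsFiniteMeasure μ] (t : ℝ) : Lp ℂ 2 μ :=
  BoundedContinuousFunction.toLp 2 μ ℂ (expBounded t)

section

variable {μ : Measure ℝ}

theorem coeFn_expLp [IsFiniteMeasure μ] (t : ℝ) :
    (expLp μ t : ℝ → ℂ) =ᵐ[μ] fun x => unitExp (t * x) :=
  BoundedContinuousFunction.coeFn_toLp 2 μ ℂ (expBounded t)

theorem inner_expLp_left [IsFiniteMeasure μ] (t : ℝ) (f : Lp ℂ 2 μ) :
    inner ℂ (expLp μ t) f = ∫ x, f x * unitExp (-(t * x)) ∂μ := by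
  rw [L2.inner_def]
  refine integral_congr_ae ?_
  filter_upwards [coeFn_expLp (μ := μ) t] with x hx
  rw [hx, RCLike.inner_apply, conj_unitExp]

theorem inner_expLp [IsFiniteMeasure μ] (s t : ℝ) :
    inner ℂ (expLp μ s) (expLp μ t) = fourierMeasure μ (t - s) := by
  rw [inner_expLp_left, fourierMeasure]
  refine integral_congr_ae ?_
  filter_upwards [coeFn_expLp (μ := μ) t] with x hx
  rw [hx, ← unitExp_add]
  ring_nf

theorem norm_expLp [IsProbabilityMeasure μ] (t : ℝ) : ‖expLp μ t‖ = 1 := by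
  have h := inner_self_eq_norm_sq_to_K (𝕜 := ℂ) (expLp μ t)
  rw [inner_expLp, sub_self, fourierMeasure_zero] at h
  have h2 : ‖expLp μ t‖ ^ 2 = 1 := by
    rw [← Complex.ofReal_inj]
    push_cast
    exact h.symm
  exact (pow_eq_one_iff_of_nonneg (norm_nonneg _) two_ne_zero).1 h2

theorem orthonormal_expLp [IsProbabilityMeasure μ] {Λ : Set ℝ}
    (h : ∀ x ∈ Λ, ∀ y ∈ Λ, x ≠ y → fourierMeasure μ (x - y) = 0) :
    Orthonormal ℂ fun l : Λ => expLp μ l := by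
  refine ⟨fun l => norm_expLp _, fun l l' hne => ?_⟩
  simp only [inner_expLp]
  exact h _ l'.2 _ l.2 fun e => hne (Subtype.ext e.symm)

theorem isSpectralPair_iff [IsProbabilityMeasure μ] {Λ : Set ℝ} :
    IsSpectralPair μ Λ ↔
      Λ.Countable ∧ ∃ e : HilbertBasis Λ ℂ (Lp ℂ 2 μ), ∀ l : Λ, e l = expLp μ l := by
  refine and_congr_right fun _ => exists_congr fun e => forall_congr' fun l => ?_
  constructor
  · exact fun h => Lp.ext (h.trans (coeFn_expLp _).symm)
  · intro h
    rw [h]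
    exact coeFn_expLp _

/-- A real integrable function all of whose Fourier coefficients vanish is zero. -/
theorem ae_eq_zero_of_integral_unitExp [IsFiniteMeasure μ] {u : ℝ → ℝ} (hu : Integrable u μ)
    (h : ∀ t, ∫ x, (u x : ℂ) * unitExp (t * x) ∂μ = 0) : u =ᵐ[μ] 0 := by
  have hu' : Integrable (fun x => -u x) μ := hu.neg
  have := isFiniteMeasure_withDensity_ofReal hu.2
  have := isFiniteMeasure_withDensity_ofReal hu'.2
  have hm : AEMeasurable (fun x => ENNReal.ofReal (u x)) μ := hu.1.aemeasurable.ennreal_ofReal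
  have hm' : AEMeasurable (fun x => ENNReal.ofReal (-u x)) μ := hu'.1.aemeasurable.ennreal_ofReal
  have hint (w : ℝ → ℝ) (hw : Integrable w μ) (t : ℝ) :
      Integrable (fun x => (ENNReal.ofReal (w x)).toReal • unitExp (t * x)) μ := by
    have h1 : Integrable (fun x => (ENNReal.ofReal (w x)).toReal) μ := by
      simpa [ENNReal.toReal_ofReal'] using hw.pos_part
    refine Integrable.mono' h1 (h1.1.smul (integrable_unitExp_mul μ t).1) ?_
    refine Filter.Eventually.of_forall fun x => ?_
    rw [norm_smul, norm_unitExp, mul_one, Real.norm_of_nonneg ENNReal.toReal_nonneg]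
  -- The positive and negative parts of `u` are densities of two finite measures with equal
  -- characteristic functions.
  have heq : μ.withDensity (fun x => ENNReal.ofReal (u x)) =
      μ.withDensity fun x => ENNReal.ofReal (-u x) := by
    refine Measure.ext_of_charFun (funext fun s => ?_)
    have hs (x : ℝ) : Complex.exp (s * x * Complex.I) = unitExp (s / (2 * Real.pi) * x) := by
      rw [unitExp_eq_exp_mul_I]
      congr 2
      norm_cast
      field_simp
    rw [charFun_apply_real, charFun_apply_real,
      integral_withDensity_eq_integral_toReal_smul₀ hm
        (Filter.Eventually.of_forall fun _ => ENNReal.ofReal_lt_top),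
      integral_withDensity_eq_integral_toReal_smul₀ hm'
        (Filter.Eventually.of_forall fun _ => ENNReal.ofReal_lt_top), ← sub_eq_zero]
    simp only [hs]
    rw [← integral_sub (hint u hu _) (hint _ hu' _), ← h (s / (2 * Real.pi))]
    refine integral_congr_ae (Filter.Eventually.of_forall fun x => ?_)
    simp only
    rw [← sub_smul, Complex.real_smul]
    congr 2
    simp only [ENNReal.toReal_ofReal']
    rcases le_total 0 (u x) with hx | hx
    · rw [max_eq_left hx, max_eq_right (by linarith), sub_zero]
    · rw [max_eq_right hx, max_eq_left (by linarith)]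
      ring
  have hne : ∫⁻ x, ENNReal.ofReal (u x) ∂μ ≠ ∞ := by
    rw [← setLIntegral_univ, ← withDensity_apply _ MeasurableSet.univ]
    exact measure_ne_top _ _
  filter_upwards [(withDensity_eq_iff hm hm' hne).1 heq] with x hx
  have h1 := congrArg ENNReal.toReal hx
  simp only [ENNReal.toReal_ofReal'] at h1
  rcases le_total 0 (u x) with h0 | h0
  · rw [max_eq_left h0, max_eq_right (by linarith)] at h1
    exact h1
  · rw [max_eq_right h0, max_eq_left (by linarith)] at h1
    simp only [Pi.zero_apply]
    linarith

/-- The exponentials are total in `L²(μ)`. -/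
theorem eq_zero_of_inner_expLp [IsFiniteMeasure μ] (f : Lp ℂ 2 μ)
    (h : ∀ t, inner ℂ (expLp μ t) f = 0) : f = 0 := by
  have hf : Integrable f μ := (Lp.memLp f).integrable one_le_two
  have h1 (t : ℝ) : ∫ x, f x * unitExp (t * x) ∂μ = 0 := by
    rw [← h (-t), inner_expLp_left]
    simp
  have h2 (t : ℝ) : ∫ x, (starRingEnd ℂ) (f x) * unitExp (t * x) ∂μ = 0 := by
    rw [← map_zero (starRingEnd ℂ), ← h1 (-t), ← integral_conj]
    simp [conj_unitExp]
  have hi1 (t : ℝ) : Integrable (fun x => f x * unitExp (t * x)) μ := by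
    refine Integrable.mono hf (hf.1.mul (integrable_unitExp_mul μ t).1) ?_
    exact Filter.Eventually.of_forall fun x => by rw [norm_mul, norm_unitExp, mul_one]
  have hfc : AEStronglyMeasurable (fun x => (starRingEnd ℂ) (f x)) μ :=
    Complex.continuous_conj.comp_aestronglyMeasurable hf.1
  have hi2 (t : ℝ) : Integrable (fun x => (starRingEnd ℂ) (f x) * unitExp (t * x)) μ := by
    refine Integrable.mono hf (hfc.mul (integrable_unitExp_mul μ t).1) ?_
    exact Filter.Eventually.of_forall fun x => by
      rw [norm_mul, norm_unitExp, mul_one, RCLike.norm_conj]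
  have hre : (fun x => (f x).re) =ᵐ[μ] 0 := by
    refine ae_eq_zero_of_integral_unitExp hf.re fun t => ?_
    have he : (fun x => ((f x).re : ℂ) * unitExp (t * x)) = fun x =>
        (2 : ℂ)⁻¹ * (f x * unitExp (t * x) + (starRingEnd ℂ) (f x) * unitExp (t * x)) := by
      funext x
      rw [Complex.re_eq_add_conj]
      ring
    rw [he, integral_const_mul, integral_add (hi1 t) (hi2 t), h1, h2, add_zero, mul_zero]
  have him : (fun x => (f x).im) =ᵐ[μ] 0 := by
    refine ae_eq_zero_of_integral_unitExp hf.im fun t => ?_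
    have he : (fun x => ((f x).im : ℂ) * unitExp (t * x)) = fun x =>
        (2 * Complex.I)⁻¹ *
          (f x * unitExp (t * x) - (starRingEnd ℂ) (f x) * unitExp (t * x)) := by
      funext x
      rw [Complex.im_eq_sub_conj]
      ring
    rw [he, integral_const_mul, integral_sub (hi1 t) (hi2 t), h1, h2, sub_zero, mul_zero]
  refine Lp.ext ?_
  filter_upwards [hre, him, Lp.coeFn_zero ℂ 2 μ] with x hx hx' h0
  rw [h0]
  exact Complex.ext hx hx'

end

/-! ### Analyticity of the exponentials in the frequency -/

/-- `2πi` times the coordinate function, cut off outside `[-R, R]`. -/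
def clippedCoordinate (R : ℝ) : BoundedContinuousFunction ℝ ℂ :=
  BoundedContinuousFunction.ofNormedAddCommGroup
    (fun s : ℝ => 2 * Real.pi * Complex.I * ((max (-R) (min R s) : ℝ) : ℂ)) (by fun_prop)
    (2 * Real.pi * |R|) (by
      intro s
      have h : |max (-R) (min R s)| ≤ |R| := by
        rcases le_total 0 R with hR | hR
        · rw [abs_of_nonneg hR, abs_le]
          exact ⟨le_max_left _ _, max_le (by linarith) (min_le_left _ _)⟩
        · rw [max_eq_left ((min_le_left _ _).trans (by linarith)), abs_neg]
      simpa [abs_of_pos Real.pi_pos] using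
        mul_le_mul_of_nonneg_left h (by positivity : (0 : ℝ) ≤ 2 * Real.pi))

theorem exp_bounded_apply (g : BoundedContinuousFunction ℝ ℂ) (s : ℝ) :
    (NormedSpace.exp g) s = Complex.exp (g s) := by
  let ev : BoundedContinuousFunction ℝ ℂ →+* ℂ :=
    { toFun := fun f => f s
      map_one' := rfl
      map_mul' := fun _ _ => rfl
      map_zero' := rfl
      map_add' := fun _ _ => rfl }
  have hev : Continuous ev := (BoundedContinuousFunction.evalCLM ℂ s).continuous
  rw [Complex.exp_eq_exp_ℂ]
  exact NormedSpace.map_exp ev hev g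

/-- Almost everywhere the cutoff is invisible, so `e_t` is the exponential of `t` times a fixed
element of the Banach algebra of bounded continuous functions. This yields analyticity in `t` in
norm. -/
theorem expLp_eq_exp_clipped {μ : Measure ℝ} [IsFiniteMeasure μ] {R : ℝ}
    (hR : ∀ᵐ x ∂μ, |x| ≤ R) (t : ℝ) :
    expLp μ t = BoundedContinuousFunction.toLp 2 μ ℂ
      (NormedSpace.exp (t • clippedCoordinate R)) := by
  refine Lp.ext ((coeFn_expLp t).trans ?_)
  filter_upwards [hR, BoundedContinuousFunction.coeFn_toLp 2 μ ℂ
    (NormedSpace.exp (t • clippedCoordinate R))] with x hx hc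
  rw [abs_le] at hx
  rw [hc, exp_bounded_apply, unitExp]
  congr 1
  simp only [BoundedContinuousFunction.coe_smul, clippedCoordinate,
    BoundedContinuousFunction.coe_ofNormedAddCommGroup, min_eq_right hx.2, max_eq_right hx.1,
    Complex.real_smul]
  push_cast
  ring

theorem analyticAt_exp_smul_clipped (R t : ℝ) :
    AnalyticAt ℝ (fun t : ℝ => NormedSpace.exp (t • clippedCoordinate R)) t :=
  AnalyticAt.comp (f := fun t : ℝ => t • clippedCoordinate R)
    (NormedSpace.exp_analytic (𝕂 := ℝ) (t • clippedCoordinate R))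
    (analyticAt_id.smul analyticAt_const)

/-- For a compactly supported measure, `t ↦ ‖T e_t‖²` is real analytic for every bounded
operator `T` on `L²(μ)`. -/
theorem analyticAt_norm_sq_expLp {μ : Measure ℝ} [IsFiniteMeasure μ] {R : ℝ}
    (hR : ∀ᵐ x ∂μ, |x| ≤ R) {E : Type*} [NormedAddCommGroup E] [InnerProductSpace ℂ E]
    (T : Lp ℂ 2 μ →L[ℂ] E) (t : ℝ) : AnalyticAt ℝ (fun t => ‖T (expLp μ t)‖ ^ 2) t := by
  let _ : NormedSpace ℝ E := NormedSpace.restrictScalars ℝ ℂ E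
  have : IsScalarTower ℝ ℂ E := RestrictScalars.isScalarTower ℝ ℂ E
  let Φ : BoundedContinuousFunction ℝ ℂ →L[ℝ] E :=
    (T.comp (BoundedContinuousFunction.toLp 2 μ ℂ)).restrictScalars ℝ
  have hg : AnalyticAt ℝ (fun t : ℝ => Φ (NormedSpace.exp (t • clippedCoordinate R))) t :=
    (Φ.analyticAt _).comp (analyticAt_exp_smul_clipped R t)
  have hin : AnalyticAt ℝ (fun p : E × E => inner ℂ p.1 p.2) (Φ (NormedSpace.exp
      (t • clippedCoordinate R)), Φ (NormedSpace.exp (t • clippedCoordinate R))) :=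
    (isBoundedBilinearMap_inner (𝕜 := ℂ) (E := E)).toContinuousLinearMap.analyticAt_bilinear _
  have hcomp := (Complex.reCLM.analyticAt _).comp (AnalyticAt.comp (f := fun t : ℝ =>
    (Φ (NormedSpace.exp (t • clippedCoordinate R)), Φ (NormedSpace.exp (t • clippedCoordinate R))))
    hin (hg.prod hg))
  convert hcomp using 1
  funext s
  rw [expLp_eq_exp_clipped hR]
  simp only [Function.comp_apply]
  exact norm_sq_eq_re_inner (𝕜 := ℂ) _

/-! ### Bessel operators -/

/-- The coefficient operator `f ↦ (⟨v i, f⟩)_i` of an orthonormal family. -/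
theorem exists_coefficient_operator {ι E : Type*} [NormedAddCommGroup E] [InnerProductSpace ℂ E]
    [CompleteSpace E] {v : ι → E} (hv : Orthonormal ℂ v) :
    ∃ T : E →L[ℂ] lp (fun _ : ι => ℂ) 2, (∀ f i, T f i = inner ℂ (v i) f) ∧
      (∀ f, ‖T f‖ ≤ ‖f‖) ∧
      ∀ f, ‖T f‖ = ‖f‖ → f ∈ (Submodule.span ℂ (Set.range v)).topologicalClosure := by
  classical
  -- `V` is the synthesis isometry and `T` its adjoint. Then `‖f - V T f‖² = ‖f‖² - ‖T f‖²`, which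
  -- settles the equality case.
  let V : lp (fun _ : ι => ℂ) 2 →L[ℂ] E := hv.orthogonalFamily.linearIsometry.toContinuousLinearMap
  have hV (c : lp (fun _ : ι => ℂ) 2) : ‖V c‖ = ‖c‖ :=
    hv.orthogonalFamily.linearIsometry.norm_map c
  have hT (f : E) : ‖V.adjoint f‖ ^ 2 = RCLike.re (inner ℂ f (V (V.adjoint f))) := by
    rw [← ContinuousLinearMap.adjoint_inner_left, ← norm_sq_eq_re_inner]
  have hle (f : E) : ‖V.adjoint f‖ ≤ ‖f‖ := by
    have h1 := hT f
    have h2 := (RCLike.re_le_norm _).trans (norm_inner_le_norm (𝕜 := ℂ) f (V (V.adjoint f)))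
    rw [← h1, hV] at h2
    by_contra hlt
    push Not at hlt
    nlinarith [norm_nonneg f]
  refine ⟨V.adjoint, fun f i => ?_, hle, fun f hf => ?_⟩
  · have h1 : V (lp.single 2 i (1 : ℂ)) = v i := by
      change hv.orthogonalFamily.linearIsometry (lp.single 2 i (1 : ℂ)) = v i
      rw [OrthogonalFamily.linearIsometry_apply_single]
      simp
    rw [← h1, ← ContinuousLinearMap.adjoint_inner_right, lp.inner_single_left]
    simp
  · have hz : ‖f - V (V.adjoint f)‖ ^ 2 = 0 := by
      rw [norm_sub_sq (𝕜 := ℂ), ← hT, hV, hf]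
      ring
    have hfV : f = V (V.adjoint f) := by
      rw [← sub_eq_zero, ← norm_eq_zero]
      exact pow_eq_zero_iff two_ne_zero |>.1 hz
    have hmem : f ∈ (hv.orthogonalFamily.linearIsometry.toLinearMap).range := ⟨_, hfV.symm⟩
    rw [hv.orthogonalFamily.range_linearIsometry] at hmem
    simpa [← LinearMap.span_singleton_eq_range, ← Submodule.span_iUnion] using hmem


/-! ### Completeness of the canonical spectrum -/

theorem exists_ae_abs_le_selfSimilarMeasure {N : ℕ} (hN : 2 ≤ N) (B : Finset ℤ)
    (hB : B.Nonempty) : ∃ R : ℝ, ∀ᵐ x ∂selfSimilarMeasure N B hB, |x| ≤ R := by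
  have hN1 : (1 : ℝ) < N := by exact_mod_cast (by omega : 1 < N)
  have hN0 : (0 : ℝ) < N := by linarith
  obtain ⟨M, hM⟩ : ∃ M : ℝ, ∀ b ∈ B, |((b : ℤ) : ℝ)| ≤ M :=
    ⟨∑ b ∈ B, |((b : ℤ) : ℝ)|, fun b hb =>
      Finset.single_le_sum (f := fun b : ℤ => |(b : ℝ)|) (fun _ _ => abs_nonneg _) hb⟩
  have hg : Summable fun k : ℕ => M * ((N : ℝ)⁻¹) ^ (k + 1) :=
    Summable.mul_left M ((summable_nat_add_iff 1).2
      (summable_geometric_of_lt_one (by positivity) (inv_lt_one_of_one_lt₀ hN1)))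
  refine ⟨∑' k : ℕ, M * ((N : ℝ)⁻¹) ^ (k + 1), ?_⟩
  rw [selfSimilarMeasure, ae_map_iff (measurable_digitSeries N B).aemeasurable
    (measurableSet_le measurable_abs measurable_const)]
  refine Filter.Eventually.of_forall fun w => ?_
  rw [← Real.norm_eq_abs]
  refine tsum_of_norm_bounded hg.hasSum fun k => ?_
  rw [norm_div, norm_pow, Real.norm_eq_abs, Real.norm_eq_abs, abs_of_pos hN0, inv_pow,
    div_eq_mul_inv]
  exact mul_le_mul_of_nonneg_right (hM _ (w k).2) (by positivity)

namespace HadamardRelations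

variable {N : ℕ} {B L : Finset ℤ}

/-- In a finite set that is closed under the transitions `x → τ_ℓ x` of positive weight, some
periodic path consists of transitions of weight one. -/
theorem exists_extreme_path (h : HadamardRelations N B L) {Z : Finset ℝ} (hne : Z.Nonempty)
    (hsucc : ∀ x ∈ Z, ∀ l ∈ L, maskFunction B (tau N l x) ≠ 0 → tau N l x ∈ Z) :
    ∃ K a, IsPeriodicPath N L K a ∧ a 0 ∈ Z ∧ ‖maskFunction B (a 0)‖ = 1 := by
  classical
  have hN := h.natCast_ne_zero
  have hex (x : ℝ) : ∃ l ∈ L, maskFunction B (tau N l x) ≠ 0 := by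
    by_contra hno
    push Not at hno
    have := h.sum_norm_sq_mask x
    rw [Finset.sum_eq_zero fun l hl => by rw [hno l hl, norm_zero, zero_pow two_ne_zero]] at this
    exact zero_ne_one this
  -- In a nonempty closed subset `M` of least size every point is a successor, since the successors
  -- form a closed subset of `M`.
  obtain ⟨M, hMfam, hMmin⟩ := Finset.exists_min_image
    (Z.powerset.filter fun M => M.Nonempty ∧
      ∀ x ∈ M, ∀ l ∈ L, maskFunction B (tau N l x) ≠ 0 → tau N l x ∈ M) Finset.card
    ⟨Z, by simpa using ⟨hne, hsucc⟩⟩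
  obtain ⟨hMZ, hMne, hMsucc⟩ := by simpa using hMfam
  have hpred : ∀ y ∈ M, ∃ x ∈ M, ∃ l ∈ L, tau N l x = y := by
    set M' := M.filter fun y => ∃ x ∈ M, ∃ l ∈ L, maskFunction B (tau N l x) ≠ 0 ∧ tau N l x = y
      with hM'
    have hsub : M' ⊆ M := Finset.filter_subset _ _
    have hmem : ∀ x ∈ M, ∀ l ∈ L, maskFunction B (tau N l x) ≠ 0 → tau N l x ∈ M' :=
      fun x hx l hl hm => Finset.mem_filter.2 ⟨hMsucc x hx l hl hm, x, hx, l, hl, hm, rfl⟩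
    have hcard : M.card ≤ M'.card := by
      refine hMmin M' ?_
      rw [Finset.mem_filter, Finset.mem_powerset]
      refine ⟨hsub.trans hMZ, ?_, fun x hx => hmem x (hsub hx)⟩
      obtain ⟨x, hx⟩ := hMne
      obtain ⟨l, hl, hm⟩ := hex x
      exact ⟨_, hmem x hx l hl hm⟩
    intro y hy
    rw [← Finset.eq_of_subset_of_card_le hsub hcard] at hy
    obtain ⟨_, x, hx, l, hl, _, he⟩ := Finset.mem_filter.1 hy
    exact ⟨x, hx, l, hl, he⟩
  let π : ℝ → UnitAddCircle := fun x => (x : UnitAddCircle)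
  have hπ (x : ℝ) (l : ℤ) : N • π (tau N l x) = π x := by
    change N • ((tau N l x : ℝ) : UnitAddCircle) = (x : UnitAddCircle)
    rw [← AddCircle.coe_nsmul, nsmul_eq_mul, tau, mul_div_cancel₀ _ hN, AddCircle.coe_add]
    have : ((l : ℝ) : UnitAddCircle) = 0 := (AddCircle.coe_eq_zero_iff 1).2 ⟨l, by simp⟩
    rw [this, add_zero]
  -- Modulo `1`, multiplication by `N` undoes each `τ_ℓ`. Predecessors show that it maps the finite
  -- image of `M` to itself, successors that it is onto; hence it is injective. Two successors of
  -- one point then agree modulo `1`, which forces equal digits, so the only positive weight is one.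
  have hinj : Set.InjOn (fun v : UnitAddCircle => N • v) (M.image π) := by
    refine Finset.injOn_of_surjOn_of_card_le _ (t := M.image π) ?_ ?_ le_rfl
    · intro v hv
      obtain ⟨y, hy, rfl⟩ := Finset.mem_image.1 (Finset.mem_coe.1 hv)
      obtain ⟨x, hx, l, _, rfl⟩ := hpred y hy
      simp only [hπ]
      exact Finset.mem_image_of_mem _ hx
    · intro v hv
      obtain ⟨x, hx, rfl⟩ := Finset.mem_image.1 (Finset.mem_coe.1 hv)
      obtain ⟨l, hl, hm⟩ := hex x
      exact ⟨π (tau N l x), Finset.mem_image_of_mem _ (hMsucc x hx l hl hm), hπ x l⟩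
  have huniq : ∀ x ∈ M, ∀ l ∈ L, ∀ l' ∈ L, maskFunction B (tau N l x) ≠ 0 →
      maskFunction B (tau N l' x) ≠ 0 → l = l' := by
    intro x hx l hl l' hl' hm hm'
    have he : π (tau N l x) = π (tau N l' x) :=
      hinj (Finset.mem_image_of_mem _ (hMsucc x hx l hl hm))
        (Finset.mem_image_of_mem _ (hMsucc x hx l' hl' hm')) (by simp only [hπ])
    have he0 : ((tau N l x - tau N l' x : ℝ) : UnitAddCircle) = 0 := by
      rw [AddCircle.coe_sub, sub_eq_zero]
      exact he
    obtain ⟨z, hz⟩ := (AddCircle.coe_eq_zero_iff 1).1 he0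
    rw [zsmul_eq_mul, mul_one] at hz
    refine h.eq_of_sub_div_mem hl hl' ?_
    have : ((l : ℝ) - l') / N = ((z : ℤ) : ℝ) := by
      rw [hz, tau, tau]
      field_simp
      ring
    rw [this]
    exact intCast_mem_periodGroup B z
  have hone : ∀ x ∈ M, ∃ l ∈ L, tau N l x ∈ M ∧ ‖maskFunction B (tau N l x)‖ = 1 := by
    intro x hx
    obtain ⟨l, hl, hm⟩ := hex x
    refine ⟨l, hl, hMsucc x hx l hl hm, ?_⟩
    have hsum := h.sum_norm_sq_mask x
    rw [Finset.sum_eq_single_of_mem l hl fun l' hl' hne' => ?_] at hsum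
    · exact (pow_eq_one_iff_of_nonneg (norm_nonneg _) two_ne_zero).1 hsum
    · by_contra hm'
      refine hne' (huniq x hx l' hl' l hl (fun e => hm' ?_) hm)
      rw [e, norm_zero, zero_pow two_ne_zero]
  choose! l hl hlM hlnorm using hone
  obtain ⟨x₀, hx₀⟩ := hMne
  let f : ℝ → ℝ := fun x => tau N (l x) x
  have hfM (n : ℕ) : f^[n] x₀ ∈ M := by
    induction n with
    | zero => exact hx₀
    | succ n ih =>
      rw [Function.iterate_succ_apply']
      exact hlM _ ih
  obtain ⟨i, j, hij, he⟩ : ∃ i j, i < j ∧ f^[i] x₀ = f^[j] x₀ := by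
    obtain ⟨i, j, hne', he⟩ := Finite.exists_ne_map_eq_of_infinite
      fun n : ℕ => (⟨f^[n] x₀, hfM n⟩ : M)
    have he' : f^[i] x₀ = f^[j] x₀ := congrArg Subtype.val he
    rcases lt_or_gt_of_ne hne' with hlt | hlt
    · exact ⟨i, j, hlt, he'⟩
    · exact ⟨j, i, hlt, he'.symm⟩
  -- Starting at `j > 0` rather than `i` makes `a 0` itself a successor, so that its mask is known
  -- to have modulus one.
  refine ⟨j - i, fun n => f^[n + j] x₀, ⟨by omega, fun n => ?_, fun n => ?_⟩, ?_, ?_⟩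
  · refine ⟨l (f^[n + j] x₀), hl _ (hfM _), ?_⟩
    rw [add_right_comm, Function.iterate_succ_apply']
  · have h2 : n + j = n + (j - i) + i := by omega
    rw [Function.iterate_add_apply, ← he, ← Function.iterate_add_apply, h2]
  · exact hMZ (hfM _)
  · obtain ⟨j', rfl⟩ : ∃ j', j = j' + 1 := ⟨j - 1, by omega⟩
    simp only [zero_add, Function.iterate_succ_apply']
    exact hlnorm _ (hfM _)

/-- Reindexing of the canonical spectrum by `(ℓ, λ) ↦ Nλ + ℓ`. -/
def spectrumEquiv (h : HadamardRelations N B L) :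
    L × canonicalSpectrum N B L ≃ canonicalSpectrum N B L :=
  Equiv.ofBijective
    (fun u => ⟨N * (u.2 : ℝ) + ((u.1 : ℤ) : ℝ), mul_add_mem_canonicalSpectrum u.2.2 u.1.2⟩) (by
      have hsub := canonicalSpectrum_subset_periodGroup (N := N) L h.zero_mem_digits
      constructor
      · intro u v huv
        obtain ⟨h1, h2⟩ := h.mul_add_injective (hsub u.2.2) (hsub v.2.2) u.1.2 v.1.2
          (congrArg Subtype.val huv)
        exact Prod.ext (Subtype.ext h1) (Subtype.ext h2)
      · intro x
        obtain ⟨y, hy, l, hl, he⟩ := h.exists_eq_mul_add x.2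
        exact ⟨(⟨l, hl⟩, ⟨y, hy⟩), Subtype.ext he.symm⟩)

theorem coe_spectrumEquiv (h : HadamardRelations N B L) (u : L × canonicalSpectrum N B L) :
    (h.spectrumEquiv u : ℝ) = N * (u.2 : ℝ) + ((u.1 : ℤ) : ℝ) := rfl

/-- The spectral function `Q(x) = ∑_{λ ∈ Λ} |μ̂(x + λ)|²` is harmonic for the transfer operator. -/
theorem spectral_function_harmonic (h : HadamardRelations N B L) {μ : Measure ℝ}
    (hμ : IsSelfSimilarMeasure N B μ) {Q : ℝ → ℝ}
    (hQ : ∀ x, HasSum (fun l : canonicalSpectrum N B L => ‖fourierMeasure μ (x + l)‖ ^ 2) (Q x))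
    (x : ℝ) : ∑ l ∈ L, ‖maskFunction B (tau N l x)‖ ^ 2 * Q (tau N l x) = Q x := by
  have hN := h.natCast_ne_zero
  have hsub := canonicalSpectrum_subset_periodGroup (N := N) L h.zero_mem_digits
  have h1 := h.spectrumEquiv.hasSum_iff.2 (hQ x)
  have h2 := h1.prod_fiberwise (g := fun l : L =>
    ‖maskFunction B (tau N l x)‖ ^ 2 * Q (tau N l x)) fun l => by
      refine (iff_of_eq (congrArg (HasSum · _) (funext fun y => ?_))).2
        ((hQ (tau N l x)).mul_left (‖maskFunction B (tau N l x)‖ ^ 2))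
      have he : (x + h.spectrumEquiv (l, y)) / N = tau N l x + y := by
        rw [coe_spectrumEquiv, tau]
        field_simp
        ring
      rw [Function.comp_apply, hμ.fourierMeasure_eq, he, maskFunction_add_of_mem _ (hsub y.2),
        norm_mul, mul_pow]
  rw [← Finset.sum_coe_sort L]
  exact (hasSum_fintype _).unique h2

/-- An analytic harmonic function that is at least one at all negatives of frequencies is at
least one everywhere. -/
theorem one_le_of_harmonic (h : HadamardRelations N B L) {Q : ℝ → ℝ}
    (hana : ∀ x, AnalyticAt ℝ Q x)
    (hharm : ∀ x, ∑ l ∈ L, ‖maskFunction B (tau N l x)‖ ^ 2 * Q (tau N l x) = Q x)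
    (hge : ∀ x, -x ∈ canonicalSpectrum N B L → 1 ≤ Q x) (x : ℝ) : 1 ≤ Q x := by
  have hN2 : (2 : ℝ) ≤ N := by exact_mod_cast h.two_le
  obtain ⟨R, hxR, hLR⟩ : ∃ R : ℝ, |x| ≤ R ∧ ∀ l ∈ L, |((l : ℤ) : ℝ)| ≤ R := by
    refine ⟨|x| + ∑ l ∈ L, |((l : ℤ) : ℝ)|, ?_, fun l hl => ?_⟩
    · have : 0 ≤ ∑ l ∈ L, |((l : ℤ) : ℝ)| := Finset.sum_nonneg fun _ _ => abs_nonneg _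
      linarith
    · have := Finset.single_le_sum (f := fun l : ℤ => |(l : ℝ)|) (fun _ _ => abs_nonneg _) hl
      have h0 := abs_nonneg x
      linarith
  have hR0 : 0 ≤ R := (abs_nonneg x).trans hxR
  have htau : ∀ y ∈ Set.Icc (-R) R, ∀ l ∈ L, tau N l y ∈ Set.Icc (-R) R := by
    intro y hy l hl
    rw [Set.mem_Icc, ← abs_le] at hy ⊢
    rw [tau, abs_div, abs_of_pos h.natCast_pos, div_le_iff₀ h.natCast_pos]
    have h1 : |y + l| ≤ |y| + |(l : ℝ)| := abs_add_le _ _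
    have h2 := hLR l hl
    nlinarith
  have hcont : Continuous Q := continuous_iff_continuousAt.2 fun y => (hana y).continuousAt
  obtain ⟨x₀, hx₀, hmin⟩ := isCompact_Icc.exists_isMinOn
    (⟨x, abs_le.1 hxR⟩ : (Set.Icc (-R) R).Nonempty) hcont.continuousOn
  have hle : ∀ y ∈ Set.Icc (-R) R, Q x₀ ≤ Q y := fun y hy => hmin hy
  refine le_trans ?_ (hle x (abs_le.1 hxR))
  set Z : Set ℝ := {y | y ∈ Set.Icc (-R) R ∧ Q y = Q x₀} with hZ
  by_cases hfin : Z.Finite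
  · have hsucc : ∀ y ∈ hfin.toFinset, ∀ l ∈ L, maskFunction B (tau N l y) ≠ 0 →
        tau N l y ∈ hfin.toFinset := by
      intro y hy l hl hm
      rw [Set.Finite.mem_toFinset] at hy ⊢
      refine ⟨htau y hy.1 l hl, ?_⟩
      -- At a minimum point `Q` is a weighted average of values no smaller than the minimum, so
      -- successors of positive weight are minimum points as well.
      have hzero : ∑ l ∈ L, ‖maskFunction B (tau N l y)‖ ^ 2 * (Q (tau N l y) - Q x₀) = 0 := by
        simp only [mul_sub, Finset.sum_sub_distrib]
        rw [hharm, ← Finset.sum_mul, h.sum_norm_sq_mask, hy.2, one_mul, sub_self]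
      have hterm := (Finset.sum_eq_zero_iff_of_nonneg fun l' hl' =>
        mul_nonneg (sq_nonneg _) (sub_nonneg.2 (hle _ (htau y hy.1 l' hl')))).1 hzero l hl
      exact sub_eq_zero.1 ((mul_eq_zero.1 hterm).resolve_left
        (pow_ne_zero _ (norm_ne_zero_iff.2 hm)))
    obtain ⟨K, a, ha, haZ, hnorm⟩ := h.exists_extreme_path
      ⟨x₀, hfin.mem_toFinset.2 ⟨hx₀, rfl⟩⟩ hsucc
    rw [Set.Finite.mem_toFinset] at haZ
    rw [← haZ.2]
    exact hge _ (h.neg_mem_canonicalSpectrum_of_path ha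
      (mem_periodGroup_of_norm_maskFunction h.zero_mem_digits hnorm))
  -- Infinitely many minimum points accumulate, so by the identity theorem `Q` is constant, with
  -- value `Q 0 ≥ 1`.
  · obtain ⟨y, _, hacc⟩ := Set.Infinite.exists_accPt_of_subset_isCompact hfin
      isCompact_Icc fun y hy => hy.1
    have hfreq : ∃ᶠ z in nhdsWithin y {y}ᶜ, Q z = Q x₀ :=
      (accPt_iff_frequently_nhdsNE.1 hacc).mono fun z hz => hz.2
    have heq := AnalyticOnNhd.eq_of_frequently_eq (fun z _ => hana z)
      (analyticOnNhd_const (v := Q x₀)) hfreq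
    have h0 := hge 0 (by simpa using h.zero_mem_canonicalSpectrum)
    rwa [heq] at h0

/-- The canonical spectrum of a Hadamard triple is a spectrum of the self-similar measure. -/
theorem isSpectralPair (h : HadamardRelations N B L) :
    IsSpectralPair (selfSimilarMeasure N B h.nonempty) (canonicalSpectrum N B L) := by
  set μ := selfSimilarMeasure N B h.nonempty with hμdef
  have hμ : IsSelfSimilarMeasure N B μ := isSelfSimilarMeasure_selfSimilarMeasure h.two_le B _
  obtain ⟨R, hR⟩ := exists_ae_abs_le_selfSimilarMeasure h.two_le B h.nonempty
  have hv : Orthonormal ℂ fun l : canonicalSpectrum N B L => expLp μ l :=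
    orthonormal_expLp fun x hx y hy hne => h.fourierMeasure_sub_eq_zero hμ hx hy hne
  obtain ⟨T, hTcoef, hTle, hTmem⟩ := exists_coefficient_operator hv
  -- The sign makes the coefficient at `λ` equal to `μ̂(-(x + λ))`, which has the modulus of `μ̂(x +
  -- λ)`.
  set Q : ℝ → ℝ := fun x => ‖T (expLp μ (-x))‖ ^ 2 with hQdef
  have hana (x : ℝ) : AnalyticAt ℝ Q x :=
    AnalyticAt.comp (f := fun x : ℝ => -x) (analyticAt_norm_sq_expLp hR T (-x)) analyticAt_id.neg
  have hQ (x : ℝ) : HasSum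
      (fun l : canonicalSpectrum N B L => ‖fourierMeasure μ (x + l)‖ ^ 2) (Q x) := by
    have h1 := lp.hasSum_norm (p := 2) (by norm_num) (T (expLp μ (-x)))
    simp only [ENNReal.toReal_ofNat, Real.rpow_ofNat, hTcoef, inner_expLp] at h1
    convert h1 using 3 with l
    rw [← norm_fourierMeasure_neg]
    ring_nf
  have hge (x : ℝ) (hx : -x ∈ canonicalSpectrum N B L) : 1 ≤ Q x := by
    have h1 := le_hasSum (hQ x) ⟨-x, hx⟩ fun _ _ => sq_nonneg _
    simpa [fourierMeasure_zero] using h1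
  have hmem (t : ℝ) : expLp μ t ∈ (Submodule.span ℂ (Set.range
      fun l : canonicalSpectrum N B L => expLp μ l)).topologicalClosure := by
    refine hTmem _ (le_antisymm (hTle _) ?_)
    have h1 := h.one_le_of_harmonic hana (h.spectral_function_harmonic hμ hQ) hge (-t)
    simp only [hQdef, neg_neg] at h1
    rw [norm_expLp]
    nlinarith [norm_nonneg (T (expLp μ t))]
  have hbot : (Submodule.span ℂ (Set.range
      fun l : canonicalSpectrum N B L => expLp μ l))ᗮ = ⊥ := by
    rw [Submodule.eq_bot_iff]
    intro f hf
    rw [← Submodule.orthogonal_closure] at hf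
    exact eq_zero_of_inner_expLp f fun t => hf _ (hmem t)
  refine isSpectralPair_iff.2 ⟨h.countable_canonicalSpectrum,
    HilbertBasis.mkOfOrthogonalEqBot hv hbot, fun l => ?_⟩
  rw [HilbertBasis.coe_mkOfOrthogonalEqBot]

/-! ### Spectral eigenvalues -/

/-- Since `τ_{tℓ}(tx) = t τ_ℓ(x)`, multiplication by `t` carries cycles to cycles, and extreme ones
remain extreme because the period group is stable under integer multiples. -/
theorem smul_canonicalSpectrum_subset (h : HadamardRelations N B L) (t : ℕ) :
    (t : ℝ) • canonicalSpectrum N B L ⊆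
      canonicalSpectrum N B (CanonicalSpectrum.dilate t L) := by
  rintro _ ⟨x, hx, rfl⟩
  have hsub : canonicalSpectrum N B L ⊆
      {x | (t : ℝ) * x ∈ canonicalSpectrum N B (CanonicalSpectrum.dilate t L)} := by
    refine canonicalSpectrum_subset (fun C hC x hx => ?_) fun x hx l hl => ?_
    · obtain ⟨K, a, ha, rfl, _⟩ := hC.1.exists_path hx
      have hmem := neg_mem_canonicalSpectrum ((ha.mul t).isExtremeCycle h.natCast_ne_zero h.nonempty
        (natCast_mul_mem_periodGroup t
          (mem_periodGroup_of_norm_maskFunction h.zero_mem_digits (hC.2 _ hx)))) ⟨0, rfl⟩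
      simpa using hmem
    · have hmem := mul_add_mem_canonicalSpectrum hx (l := t * l) (mem_dilate.2 ⟨l, hl, rfl⟩)
      have he : (t : ℝ) * (N * x + l) = N * (t * x) + ((t * l : ℤ) : ℝ) := by
        push_cast
        ring
      change (t : ℝ) * (N * x + l) ∈ canonicalSpectrum N B (CanonicalSpectrum.dilate t L)
      rwa [he]
  exact hsub hx

/-- Dividing an extreme cycle of `tL` by `t` gives a cycle of `L`; saturation is precisely what
makes it extreme. -/
theorem canonicalSpectrum_dilate_subset (h : HadamardRelations N B L) {t : ℕ} (ht0 : t ≠ 0)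
    (hsat : IsSaturatedAt N B L t) :
    canonicalSpectrum N B (CanonicalSpectrum.dilate t L) ⊆
      (t : ℝ) • canonicalSpectrum N B L := by
  have ht' : (t : ℝ) ≠ 0 := by exact_mod_cast ht0
  refine canonicalSpectrum_subset (fun C hC x hx => ?_) fun x hx l hl => ?_
  · obtain ⟨K, a, ha, rfl, _⟩ := hC.1.exists_path hx
    have hper : a 0 / t ∈ periodGroup B := by
      refine hsat K _ (ha.div ht0) ?_
      rw [mul_div_cancel₀ _ ht']
      exact mem_periodGroup_of_norm_maskFunction h.zero_mem_digits (hC.2 _ hx)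
    refine ⟨-(a 0 / t), h.neg_mem_canonicalSpectrum_of_path (ha.div ht0) hper, ?_⟩
    simp only [smul_eq_mul]
    field_simp
  · obtain ⟨y, hy, rfl⟩ := hx
    obtain ⟨m, hm, rfl⟩ := mem_dilate.1 hl
    refine ⟨N * y + m, mul_add_mem_canonicalSpectrum hy hm, ?_⟩
    simp only [smul_eq_mul]
    push_cast
    ring

theorem isSpectralEigenvalue_of_isSaturatedAt (h : HadamardRelations N B L) {t : ℕ}
    (ht0 : t ≠ 0) (ht : t.Coprime N) (hsat : IsSaturatedAt N B L t) :
    IsSpectralEigenvalue (selfSimilarMeasure N B h.nonempty) (canonicalSpectrum N B L) t := by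
  rw [IsSpectralEigenvalue, (h.smul_canonicalSpectrum_subset t).antisymm
    (h.canonicalSpectrum_dilate_subset ht0 hsat)]
  exact (h.dilate ht0 ht).isSpectralPair

/-- If `tΛ` is a spectrum, then `t` maps no new periodic point into the period group. -/
theorem isSaturatedAt_of_isSpectralEigenvalue (h : HadamardRelations N B L) {t : ℕ}
    (ht0 : t ≠ 0) (ht : t.Coprime N)
    (hsp : IsSpectralEigenvalue (selfSimilarMeasure N B h.nonempty)
      (canonicalSpectrum N B L) t) : IsSaturatedAt N B L t := by
  set μ := selfSimilarMeasure N B h.nonempty with hμdef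
  have hμ : IsSelfSimilarMeasure N B μ := isSelfSimilarMeasure_selfSimilarMeasure h.two_le B _
  have ht' : (t : ℝ) ≠ 0 := by exact_mod_cast ht0
  intro K a ha hta
  have hd := h.dilate ht0 ht
  have hmem : -((t : ℝ) * a 0) ∈ canonicalSpectrum N B (CanonicalSpectrum.dilate t L) :=
    hd.neg_mem_canonicalSpectrum_of_path (ha.mul t) hta
  obtain ⟨_, e, he⟩ := isSpectralPair_iff.1 hsp
  by_contra hnot
  have hsub : (t : ℝ) • canonicalSpectrum N B L ⊆
      canonicalSpectrum N B (CanonicalSpectrum.dilate t L) :=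
    h.smul_canonicalSpectrum_subset t
  have hnotmem : -((t : ℝ) * a 0) ∉ (t : ℝ) • canonicalSpectrum N B L := by
    rintro ⟨y, hy, hye⟩
    have hy' : a 0 = -y := mul_left_cancel₀ ht' (by
      simp only [smul_eq_mul] at hye
      linarith)
    rw [hy'] at hnot
    exact hnot (neg_mem (canonicalSpectrum_subset_periodGroup L h.zero_mem_digits hy))
  -- A frequency of `Λ(tL)` outside `tΛ` would give a unit vector orthogonal to the whole basis.
  have hzero : expLp μ (-((t : ℝ) * a 0)) = 0 := by
    refine (map_eq_zero_iff e.repr e.repr.injective).1 ?_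
    ext l
    rw [e.repr_apply_apply, he, inner_expLp]
    exact hd.fourierMeasure_sub_eq_zero hμ hmem (hsub l.2) fun heq => hnotmem (heq ▸ l.2)
  have := norm_expLp (μ := μ) (-((t : ℝ) * a 0))
  rw [hzero, norm_zero] at this
  exact zero_ne_one this

end HadamardRelations

end CanonicalSpectrum

end

theorem theorem3 (N : ℕ) (B L : Finset ℤ)
    (hT : CanonicalSpectrum.IsHadamardTriple N B L)
    (h0B : (0 : ℤ) ∈ B) (h0L : (0 : ℤ) ∈ L) (hlt : B.card < N)
    (k : ℕ) (p : Fin k → ℕ) (hp : ∀ i, (p i).Prime) (hinj : Function.Injective p)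
    (hcop : Nat.Coprime (∏ i, p i) N) :
    ∃ n₀ : ℕ, ∀ n ≥ n₀,
      CanonicalSpectrum.IsSpectralEigenvalue
          (CanonicalSpectrum.selfSimilarMeasure N B hT.nonempty)
          (CanonicalSpectrum.canonicalSpectrum N B L)
          ((((∏ i, p i) ^ n : ℕ)) : ℝ) →
        ∀ m : Fin k → ℕ,
          CanonicalSpectrum.IsSpectralEigenvalue
            (CanonicalSpectrum.selfSimilarMeasure N B hT.nonempty)
            (CanonicalSpectrum.canonicalSpectrum N B L)
            (((∏ i, p i ^ m i : ℕ)) : ℝ) := by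
  have h := hT.relations h0B h0L
  set P := ∏ i, p i with hP
  have hP0 : P ≠ 0 := Finset.prod_ne_zero_iff.2 fun i _ => (hp i).ne_zero
  obtain ⟨n₀, hn₀⟩ := h.exists_saturated hlt hP0 hcop
  refine ⟨n₀, fun n hn hsp m => ?_⟩
  have hsat := hn₀ n hn (h.isSaturatedAt_of_isSpectralEigenvalue (pow_ne_zero n hP0)
    (hcop.pow_left n) hsp)
  -- The sum of the exponents is a convenient common bound for all `m i`.
  have hdvd : (∏ i, p i ^ m i) ∣ P ^ ∑ i, m i := by
    rw [hP, ← Finset.prod_pow]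
    exact Finset.prod_dvd_prod_of_dvd _ _ fun i hi =>
      pow_dvd_pow _ (Finset.single_le_sum (fun _ _ => Nat.zero_le _) hi)
  exact h.isSpectralEigenvalue_of_isSaturatedAt (ne_zero_of_dvd_ne_zero (pow_ne_zero _ hP0) hdvd)
    (Nat.Coprime.coprime_dvd_left hdvd (hcop.pow_left _)) (hsat _ _ hdvd)
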